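/- **Setting.** Let $\mathcal T_h$ be a conforming mesh of closed triangles of a polygonal domain $\Omega\subset\mathbb R^2$, with set of edges $\mathcal F_h$. It is shape-regular with constant $\sigma>0$: every $T\in\mathcal T_h$ contains a disc of radius $h_T/\sigma$, where $h_T=\operatorname{diam}T$; $h_F$ is the length of an edge $F$. Let $\Omega^1,\Omega^2$ be disjoint open sets with $\Omega^1\cup\Omega^2=\Omega\setminus\Gamma$, $\Gamma=\partial\Omega^1\cap\partial\Omega^2$, such that $\Gamma_T=T\cap\Gamma$ is a (possibly degenerate) line segment for every $T$ in $\mathcal T_h^\Gamma=\{T\in\mathcal T_h: T\cap\Gamma\ne\emptyset\}$. Let $k_1,k_2>0$ (the values of the diffusion coefficient $K$ in $\Omega^1,\Omega^2$) and $k_\Gamma=k_1k_2/(k_1+k_2)$. Every edge carries a fixed unit normal $n_F$, outward if $F\subset\partial\Omega$; it points from $T_F^-$ to $T_F^+$, and $[\![v]\!]=v^--v^+$ on interior edges, $[\![v]\!]=v$ on boundary edges. Let $\mathcal T_h^i=\{T:T\cap\Omega^i\neq\emptyset\}$ and $\Omega_h^i=\bigcup_{T\in\mathcal T_h^i}T$.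 The edge sets $\mathcal F_h^i$ and the sets of nodes $\mathring{\mathcal N}_h^i$ are taken in one of the following two ways. * (A) $\mathcal F_h^i=\{F\in\mathcal F_h: F\cap\Omega^i\ne\emptyset\}$ (so edges on $\partial\Omega$ are not included), and $\mathring{\mathcal N}_h^i$ is the set of nodes in the interior of $\Omega_h^i$. * (B) $\mathcal F_h^i=\{F\in\mathcal F_h: F\cap(\overline{\Omega^i}\setminus\Gamma)\ne\emptyset\}$ (so edges on $\partial\Omega$ are included), and $\mathring{\mathcal N}_h^i$ is the set of nodes in the interior of $\Omega_h^i$ relative to $\overline\Omega$; here it is assumed that $\partial\Omega$ does not touch itself, i.e. each node lies on at most two boundary edges. Let $\mathcal F_g^i$ be the set of $F\in\mathcal F_h^i$ such that a triangle with edge $F$ meets $\Gamma$. Let $\mathcal D_h=\mathcal D_h^1\times\mathcal D_h^2$ and $\mathcal M_h=\mathcal M_h^1\times\mathcal M_h^2$, where $\mathcal D_h^i$ is the space of functions that are $P^1$ on each $T\in\mathcal T_h^i$ (discontinuous across edges), and $\mathcal M_h^i$ is the space of functions $\mu$ that are $P^1$ on each $F\in\mathcal F_h^i$ and satisfy $$\sum_{F\in\mathcal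 F_h^i,\,F\ni N}\mathfrak s_{F,N}\,h_F\,\mu|_F(N)=0\qquad\text{for all } N\in\mathring{\mathcal N}_h^i ,$$ $\mathfrak s_{F,N}=1$ if $n_F$ points in the clockwise sense around $N$ and $-1$ otherwise. With $[v_h]=v_h^1-v_h^2$ on $\Gamma$ and elementwise gradients, put $$\|v_h\|_h^2=\sum_{i=1}^2\Big(k_i\|\nabla v_h^i\|_{L^2(\Omega^i)}^2+\sum_{F\in\mathcal F_g^i}k_ih_F\|[\![\partial_nv_h^i]\!]\|_{L^2(F)}^2\Big)+\sum_{T\in\mathcal T_h^\Gamma}\frac{k_\Gamma}{h_T}\|[v_h]\|_{L^2(\Gamma_T)}^2,$$ $$\|v_h\|_{\mathcal D_h}^2=\|v_h\|_h^2+\sum_{i=1}^2\sum_{F\in\mathcal F_h^i}k_ih_F^{-1}\|[\![v_h^i]\!]\|_{L^2(F)}^2,\qquad \|\mu_h\|_{\mathcal M_h}^2=\sum_{i=1}^2\sum_{F\in\mathcal F_h^i}k_ih_F\|\mu_h^i\|_{L^2(F)}^2,$$ $$b_h(\mu_h,v_h)=\sum_{i=1}^2\sum_{F\in\mathcal F_h^i}\frac{k_ih_F}2\sum_{N\text{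 endpoint of }F}\mu_h^i|_F(N)\,[\![v_h^i]\!](N).$$ **Theorem.** For every $\sigma>0$ there is a constant $\beta>0$, depending only on $\sigma$ (in particular independent of the mesh size $h$, of $K$ and of $\Gamma$), such that in the setting above, both for (A) and for (B), $$\inf_{0\ne\mu_h\in\mathcal M_h}\ \sup_{v_h\in\mathcal D_h,\ \|v_h\|_{\mathcal D_h}\ne0}\ \frac{b_h(\mu_h,v_h)}{\|\mu_h\|_{\mathcal M_h}\,\|v_h\|_{\mathcal D_h}}\ \ge\ \beta .$$ -/

import Mathlib

open MeasureTheory Topology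

/-- The Euclidean plane. -/
abbrev Pt := EuclideanSpace ℝ (Fin 2)

/-- The closed triangle (or edge) with the given set of vertices. -/
abbrev hull (s : Finset Pt) : Set Pt := convexHull ℝ (s : Set Pt)

/-- Clockwise rotation by a right angle. -/
noncomputable def cw (x : Pt) : Pt := !₂[x 1, -x 0]

/-- `P¹(s)`: the functions on `s` that are restrictions of affine functions; a function on `s` is
represented by its extension by zero, so that distinct elements are distinct functions on `s`. -/
def P1On (s : Set Pt) : Set (Pt → ℝ) :=
  {f | ∃ g : Pt →ᵃ[ℝ] ℝ, f = s.indicator g}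

/-- A conforming triangular mesh in the plane; a triangle is given by its set of vertices. -/
structure TriMesh where
  cells : Finset (Finset Pt)
  card_cell : ∀ T ∈ cells, T.card = 3
  nondegenerate : ∀ T ∈ cells, AffineIndependent ℝ ((↑) : T → Pt)
  conforming : ∀ T ∈ cells, ∀ T' ∈ cells,
    hull T ∩ hull T' ⊆ convexHull ℝ ((T : Set Pt) ∩ (T' : Set Pt))

namespace TriMesh

noncomputable section

open scoped Classical

variable (𝒯 : TriMesh)

/-- The polygonal domain `Ω` triangulated by the mesh. -/
def domain : Set Pt := interior (⋃ T ∈ 𝒯.cells, hull T)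

/-- `𝓕_h`, an edge being given by its two endpoints. -/
def edges : Finset (Finset Pt) := 𝒯.cells.biUnion (Finset.powersetCard 2)

/-- The nodes of the mesh. -/
def nodes : Finset Pt := 𝒯.cells.biUnion id

/-- A boundary edge is an edge of only one triangle. -/
def IsBoundaryEdge (F : Finset Pt) : Prop :=
  F ∈ 𝒯.edges ∧ (𝒯.cells.filter (fun T => F ⊆ T)).card = 1

/-- Shape regularity with constant `σ`: each triangle `T` contains a disc of radius `h_T / σ`. -/
def IsRegular (σ : ℝ) : Prop :=
  ∀ T ∈ 𝒯.cells, ∃ c : Pt, Metric.closedBall c (Metric.diam (hull T) / σ) ⊆ hull T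

/-- The boundary of the polygonal domain does not touch itself: a node lies on at most two
boundary edges. -/
def HasSimpleBoundary : Prop :=
  ∀ N ∈ 𝒯.nodes, (𝒯.edges.filter (fun F => N ∈ F ∧ 𝒯.IsBoundaryEdge F)).card ≤ 2

end

end TriMesh

/-- A mesh of `Ω`, two subdomains `Ω¹, Ω²` (indexed by `Fin 2`) separated by the interface
`Γ = ∂Ω¹ ∩ ∂Ω²`, which meets each triangle in a (possibly degenerate) line segment if at all, and
a choice of unit normals to the edges, outward on `∂Ω`. -/
structure CutMesh extends TriMesh where
  sub : Fin 2 → Set Pt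
  isOpen_sub : ∀ i, IsOpen (sub i)
  disjoint_sub : Disjoint (sub 0) (sub 1)
  union_sub : sub 0 ∪ sub 1 = toTriMesh.domain \ (frontier (sub 0) ∩ frontier (sub 1))
  interface_line : ∀ T ∈ cells, (hull T ∩ (frontier (sub 0) ∩ frontier (sub 1))).Nonempty →
    ∃ p q : Pt, hull T ∩ (frontier (sub 0) ∩ frontier (sub 1)) = segment ℝ p q
  normal : Finset Pt → Pt
  norm_normal : ∀ F ∈ toTriMesh.edges, ‖normal F‖ = 1
  normal_perp : ∀ F ∈ toTriMesh.edges, ∀ M ∈ F, ∀ N ∈ F, inner ℝ (normal F) (M - N) = 0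
  normal_outward : ∀ F, toTriMesh.IsBoundaryEdge F → ∀ T ∈ cells, F ⊆ T →
    ∀ P ∈ T, P ∉ F → ∀ N ∈ F, inner ℝ (normal F) (P - N) < 0

/-- Two ways to treat the edges on `∂Ω`. With `interior`, the multipliers live on the edges that
meet the open set `Ωⁱ`, hence not on `∂Ω`, and are constrained at the nodes interior to `Ω_hⁱ`.
With `withBoundary`, they also live on the edges of `∂Ω` that meet `∂Ωⁱ \ Γ`, and are
constrained at the nodes interior to `Ω_hⁱ` relative to the closure of `Ω`. -/
inductive EdgeConvention
  | interior
  | withBoundary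

namespace CutMesh

noncomputable section

open scoped Classical

variable (S : CutMesh)

/-- The interface `Γ`. -/
def Γ : Set Pt := frontier (S.sub 0) ∩ frontier (S.sub 1)

/-- `𝓣_hⁱ`. -/
def cellsOf (i : Fin 2) : Finset (Finset Pt) :=
  S.cells.filter (fun T => (hull T ∩ S.sub i).Nonempty)

/-- `Ω_hⁱ`. -/
def patch (i : Fin 2) : Set Pt := ⋃ T ∈ S.cellsOf i, hull T

/-- `𝓣_h^Γ`. -/
def cutCells : Finset (Finset Pt) := S.cells.filter (fun T => (hull T ∩ S.Γ).Nonempty)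

/-- The set that an edge has to meet in order to belong to `𝓕_hⁱ`. -/
def target (c : EdgeConvention) (i : Fin 2) : Set Pt :=
  match c with
  | .interior => S.sub i
  | .withBoundary => closure (S.sub i) \ S.Γ

/-- `𝓕_hⁱ`. -/
def edgesOf (c : EdgeConvention) (i : Fin 2) : Finset (Finset Pt) :=
  S.edges.filter (fun F => (hull F ∩ S.target c i).Nonempty)

/-- The nodes at which the multipliers in `𝓜_hⁱ` are constrained. -/
def IsConstrainedNode (c : EdgeConvention) (i : Fin 2) (N : Pt) : Prop :=
  N ∈ S.nodes ∧
    match c with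
    | .interior => S.patch i ∈ 𝓝 N
    | .withBoundary => S.patch i ∈ 𝓝[closure S.domain] N

/-- `𝓕_gⁱ`: the edges of `𝓕_hⁱ` with an adjacent triangle that meets `Γ`. -/
def ghostEdges (c : EdgeConvention) (i : Fin 2) : Finset (Finset Pt) :=
  (S.edgesOf c i).filter (fun F => ∃ T ∈ S.cutCells, F ⊆ T)

/-- `h_F`. -/
def len (F : Finset Pt) : ℝ := Metric.diam (hull F)

/-- `1` if `T` is the triangle `T_F⁻` that `n_F` leaves, and `-1` if it is `T_F⁺`. -/
def outSign (T F : Finset Pt) : ℝ :=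
  if ∀ P ∈ T, P ∉ F → ∀ N ∈ F, inner ℝ (S.normal F) (P - N) < 0 then 1 else -1

/-- `𝔰_{F,N}`: whether `n_F` points in the clockwise sense around the endpoint `N` of `F`. -/
def nodeSign (F : Finset Pt) (N : Pt) : ℝ :=
  if ∀ M ∈ F, M ≠ N → 0 < inner ℝ (S.normal F) (cw (M - N)) then 1 else -1

/-- `𝓓_hⁱ`: an affine function on each triangle of `𝓣_hⁱ`. -/
abbrev BrokenP1 (i : Fin 2) : Type := S.cellsOf i → (Pt →ᵃ[ℝ] ℝ)

/-- `𝓓_h = 𝓓_h¹ × 𝓓_h²`. -/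
abbrev D : Type := (i : Fin 2) → S.BrokenP1 i

/-- `𝓜_h = 𝓜_h¹ × 𝓜_h²`. -/
def M (c : EdgeConvention) : Set ((i : Fin 2) → S.edgesOf c i → Pt → ℝ) :=
  {μ | ∀ i, (∀ F : S.edgesOf c i, μ i F ∈ P1On (hull F.1)) ∧
    ∀ N, S.IsConstrainedNode c i N →
      ∑ F : S.edgesOf c i, (if N ∈ F.1 then S.nodeSign F.1 N * len F.1 * μ i F N else 0) = 0}

variable {S}

/-- The jump of `v` across `F`: `v⁻ - v⁺` on an interior edge, `v` on a boundary edge. -/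
def jump {i : Fin 2} (v : S.BrokenP1 i) (F : Finset Pt) (x : Pt) : ℝ :=
  ∑ T : S.cellsOf i, if F ⊆ T.1 then S.outSign T.1 F * v T x else 0

/-- The jump of the normal derivative `∂_n v = ∇v · n_F` across `F`. -/
def normalJump {i : Fin 2} (v : S.BrokenP1 i) (F : Finset Pt) (x : Pt) : ℝ :=
  ∑ T : S.cellsOf i,
    if F ⊆ T.1 then S.outSign T.1 F * inner ℝ (gradient (v T) x) (S.normal F) else 0

/-- The trace of `v` on `Γ_T = T ∩ Γ`. If `T` belongs to `𝓣_hⁱ`, it is taken from `T`. Otherwise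
`Γ_T` is an edge of `T` or a point, and the trace is taken from the triangle of `𝓣_hⁱ` on the
other side of that edge (the sum has one term at every `x` in the relative interior of it). -/
def interfaceTrace {i : Fin 2} (v : S.BrokenP1 i) (T : Finset Pt) (x : Pt) : ℝ :=
  if h : T ∈ S.cellsOf i then v ⟨T, h⟩ x
  else ∑ T' : S.cellsOf i, if (T ∩ T'.1).card = 2 ∧ x ∈ hull T'.1 then v T' x else 0

/-- The norm `‖·‖_h`, extended to `𝓓_h` with the elementwise gradient. -/
def normH (c : EdgeConvention) (k : Fin 2 → ℝ) (v : S.D) : ℝ :=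
  √((∑ i, ((∑ T : S.cellsOf i,
          k i * (∫ x in hull T.1 ∩ S.sub i, ‖gradient (v i T) x‖ ^ 2))
        + ∑ F ∈ S.ghostEdges c i,
          k i * len F * (∫ x in hull F, normalJump (v i) F x ^ 2 ∂μH[1])))
    + ∑ T ∈ S.cutCells, k 0 * k 1 / (k 0 + k 1) / Metric.diam (hull T) *
        (∫ x in hull T ∩ S.Γ,
          (interfaceTrace (v 0) T x - interfaceTrace (v 1) T x) ^ 2 ∂μH[1]))

/-- The norm of `𝓓_h`. -/
def normD (c : EdgeConvention) (k : Fin 2 → ℝ) (v : S.D) : ℝ :=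
  √(normH c k v ^ 2
    + ∑ i, ∑ F ∈ S.edgesOf c i,
        k i * (len F)⁻¹ * (∫ x in hull F, jump (v i) F x ^ 2 ∂μH[1]))

/-- The norm of `𝓜_h`. -/
def normM {c : EdgeConvention} (k : Fin 2 → ℝ) (μ : (i : Fin 2) → S.edgesOf c i → Pt → ℝ) : ℝ :=
  √(∑ i, ∑ F : S.edgesOf c i,
      k i * len F.1 * (∫ x in hull F.1, μ i F x ^ 2 ∂μH[1]))

/-- The bilinear form `b_h`. -/
def b {c : EdgeConvention} (k : Fin 2 → ℝ) (μ : (i : Fin 2) → S.edgesOf c i → Pt → ℝ)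
    (v : S.D) : ℝ :=
  ∑ i, ∑ F : S.edgesOf c i, k i * len F.1 / 2 * ∑ N ∈ F.1, μ i F N * jump (v i) F.1 N

/-- The inf-sup constant of `b_h`, the supremum being over the `v` of non-zero norm. -/
def infSup (S : CutMesh) (c : EdgeConvention) (k : Fin 2 → ℝ) : EReal :=
  ⨅ μ ∈ S.M c, ⨅ _ : μ ≠ 0, ⨆ v : S.D, ⨆ _ : normD c k v ≠ 0,
    ((b k μ v / (normM k μ * normD c k v) : ℝ) : EReal)

end

end CutMesh

/-! ### Affine functions and barycentric coordinates on a triangle -/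

section Triangle

open scoped Classical

/-! Functions in `D` are fully discontinuous, so one can look for a `v` whose jump across each edge
`F` of 𝓕_hⁱ equals `h_F μ|_F(N)` at both endpoints `N`. With `Q = ∑ kᵢ ∑_F ∑_N (h_F μ|_F(N))²`, such
a `v` gives `b(μ, v) = Q / 2`. Since `‖μ‖² ≤ Q` and `‖v‖² ≤ B² Q`, the quotient is at least `1 /
(2B)`. The work lies in finding `v` with nodal values controlled by `Q`
(`exists_broken_of_multiplier`) and in bounding its norm by nodal values and jumps (`normD_sq_le`).

The construction decouples over the nodes: at `N` the unknowns are the values of `v` at `N` on the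
triangles of 𝓣_hⁱ around `N`, and each edge of 𝓕_hⁱ at `N` gives one equation with coefficients `0,
±1`. It is solvable if the data annihilate the cokernel (`sum_mul_eq_zero`). A cokernel vector,
corrected by the signs 𝔰_{F,N} and extended by zero to the edges outside 𝓕_hⁱ, takes equal values on
the two edges at `N` of each triangle of 𝓣_hⁱ. A non-zero value therefore spreads from triangle to
triangle. By planar topology, with a parity argument when `N` is on the boundary, it reaches every
edge at `N`; then `N` is a constrained node, the vector is a multiple of the signs, and
orthogonality is exactly the constraint in 𝓜_h.

Uniformity comes from finiteness: shape regularity bounds the number of triangles at a node by `σ²`,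
so only finitely many sign matrices occur (`exists_uniformly_bounded_solution`). The norm bounds are
scaling estimates on each triangle, with overlap counts depending on `σ`. The contrast of the
coefficients is harmless because `k_Γ ≤ min(k₁, k₂)` and every other term carries a single `kᵢ`. -/

theorem AffineMap.continuous_real (a : Pt →ᵃ[ℝ] ℝ) : Continuous a :=
  a.continuous_of_finiteDimensional

/-- The preimage of an interval under an affine map is convex. This is how values at vertices
control all values on a triangle or an edge. -/
theorem abs_le_on_convexHull (a : Pt →ᵃ[ℝ] ℝ) {s : Set Pt} {m : ℝ} (h : ∀ x ∈ s, |a x| ≤ m)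
    {x : Pt} (hx : x ∈ convexHull ℝ s) : |a x| ≤ m := by
  have hc : Convex ℝ (a ⁻¹' Set.Icc (-m) m) := (convex_Icc _ _).affine_preimage a
  exact abs_le.2 (convexHull_min (fun y hy => abs_le.1 (h y hy)) hc hx)

theorem eq_zero_on_convexHull (a : Pt →ᵃ[ℝ] ℝ) {s : Set Pt} (h : ∀ x ∈ s, a x = 0) {x : Pt}
    (hx : x ∈ convexHull ℝ s) : a x = 0 :=
  abs_nonpos_iff.1 (abs_le_on_convexHull a (m := 0) (fun y hy => by simp [h y hy]) hx)

/-- A non-degenerate triangle, given by its vertices. -/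
def IsTriangle (T : Finset Pt) : Prop := T.card = 3 ∧ AffineIndependent ℝ ((↑) : T → Pt)

theorem IsTriangle.affineSpan_eq_top {T : Finset Pt} (hT : IsTriangle T) :
    affineSpan ℝ (Set.range ((↑) : T → Pt)) = ⊤ := by
  rw [hT.2.affineSpan_eq_top_iff_card_eq_finrank_add_one]
  simp [hT.1]

/-- The vertices of a triangle as an affine basis of the plane. -/
noncomputable def IsTriangle.basis {T : Finset Pt} (hT : IsTriangle T) : AffineBasis T ℝ Pt :=
  ⟨(↑), hT.2, hT.affineSpan_eq_top⟩

/-- The barycentric coordinate of the vertex `P` of the triangle `T`. -/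
noncomputable def bary (T : Finset Pt) (P : Pt) : Pt →ᵃ[ℝ] ℝ :=
  if h : IsTriangle T ∧ P ∈ T then h.1.basis.coord ⟨P, h.2⟩ else 0


theorem bary_eq_coord {T : Finset Pt} (hT : IsTriangle T) (P : T) :
    bary T P = hT.basis.coord P := by
  rw [bary, dif_pos ⟨hT, P.2⟩]

theorem bary_apply {T : Finset Pt} (hT : IsTriangle T) {P Q : Pt} (hP : P ∈ T) (hQ : Q ∈ T) :
    bary T P Q = if P = Q then 1 else 0 := by
  have := hT.basis.coord_apply ⟨P, hP⟩ ⟨Q, hQ⟩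
  rw [← bary_eq_coord hT] at this
  have hv : hT.basis ⟨Q, hQ⟩ = Q := rfl
  simpa [hv] using this

theorem affineMap_ext {T : Finset Pt} (hT : IsTriangle T) {a b : Pt →ᵃ[ℝ] ℝ}
    (h : ∀ P ∈ T, a P = b P) : a = b :=
  AffineMap.ext_on hT.affineSpan_eq_top (by rintro _ ⟨P, rfl⟩; exact h P P.2)

theorem mem_hull_iff {T : Finset Pt} (hT : IsTriangle T) {x : Pt} :
    x ∈ hull T ↔ ∀ P ∈ T, 0 ≤ bary T P x := by
  have h := hT.basis.convexHull_eq_nonneg_coord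
  have hr : Set.range hT.basis = (T : Set Pt) := by
    change Set.range ((↑) : T → Pt) = T
    simp
  rw [hr] at h
  rw [hull, h]
  simp only [Set.mem_ofPred_eq, Subtype.forall]
  exact forall₂_congr fun P hP => by rw [← bary_eq_coord hT ⟨P, hP⟩]

/-- Nodal interpolation: vertex values can be prescribed freely on each triangle, which is what
decouples the nodes in the construction of `v`. -/
theorem exists_affineMap_eq {T : Finset Pt} (hT : IsTriangle T) (f : Pt → ℝ) :
    ∃ a : Pt →ᵃ[ℝ] ℝ, ∀ P ∈ T, a P = f P := by
  have key : ∀ s ⊆ T, ∃ a : Pt →ᵃ[ℝ] ℝ, ∀ P ∈ T, a P = if P ∈ s then f P else 0 := by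
    intro s
    induction s using Finset.induction_on with
    | empty => exact fun _ => ⟨0, by simp⟩
    | insert Q s hQ ih =>
      intro hs
      obtain ⟨a, ha⟩ := ih ((Finset.subset_insert _ _).trans hs)
      refine ⟨a + f Q • bary T Q, fun P hP => ?_⟩
      have hQT := hs (Finset.mem_insert_self _ _)
      rw [AffineMap.coe_add, Pi.add_apply, AffineMap.coe_smul, Pi.smul_apply, ha P hP,
        bary_apply hT hQT hP]
      by_cases hPQ : Q = P
      · subst hPQ; simp [hQ]
      · simp [hPQ, Ne.symm hPQ]
  obtain ⟨a, ha⟩ := key T subset_rfl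
  exact ⟨a, fun P hP => by rw [ha P hP, if_pos hP]⟩

theorem isClosed_hull (T : Finset Pt) : IsClosed (hull T) :=
  (T.finite_toSet.isCompact_convexHull ℝ).isClosed

theorem IsTriangle.exists_vertices {T : Finset Pt} (hT : IsTriangle T) {N : Pt} (hN : N ∈ T) :
    ∃ P Q, N ≠ P ∧ N ≠ Q ∧ P ≠ Q ∧ T = {N, P, Q} := by
  have h2 : (T.erase N).card = 2 := by rw [Finset.card_erase_of_mem hN, hT.1]
  obtain ⟨P, Q, hPQ, he⟩ := Finset.card_eq_two.1 h2
  have hP : P ∈ T.erase N := by simp [he]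
  have hQ : Q ∈ T.erase N := by simp [he]
  refine ⟨P, Q, (Finset.ne_of_mem_erase hP).symm, (Finset.ne_of_mem_erase hQ).symm, hPQ, ?_⟩
  rw [← Finset.insert_erase hN, he]

theorem IsTriangle.exists_third {T : Finset Pt} (hT : IsTriangle T) {F : Finset Pt}
    (hF : F ⊆ T) (hc : F.card = 2) {N : Pt} (hN : N ∈ F) :
    ∃ P Q, N ≠ P ∧ N ≠ Q ∧ P ≠ Q ∧ T = {N, P, Q} ∧ F = {N, P} := by
  obtain ⟨P, hP⟩ := Finset.card_eq_one.1
    (show (F.erase N).card = 1 by rw [Finset.card_erase_of_mem hN, hc])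
  obtain ⟨Q, hQ⟩ := Finset.card_eq_one.1
    (show (T \ F).card = 1 by rw [Finset.card_sdiff_of_subset hF, hc, hT.1])
  have hF' : F = {N, P} := by rw [← Finset.insert_erase hN, hP]
  have hPF : P ∈ F.erase N := by simp [hP]
  have hQF : Q ∈ T \ F := by simp [hQ]
  have hQF' := (Finset.mem_sdiff.1 hQF).2
  refine ⟨P, Q, (Finset.ne_of_mem_erase hPF).symm, ?_, ?_, ?_, hF'⟩
  · rintro rfl; exact hQF' hN
  · rintro rfl; exact hQF' (Finset.mem_of_mem_erase hPF)
  · rw [← Finset.sdiff_union_of_subset hF, hQ, hF']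
    ext; simp; tauto

theorem bary_add_bary_add_bary {T : Finset Pt} (hT : IsTriangle T) {N P Q : Pt} (hNP : N ≠ P)
    (hNQ : N ≠ Q) (hPQ : P ≠ Q) (hTe : T = {N, P, Q}) (x : Pt) :
    bary T N x + bary T P x + bary T Q x = 1 := by
  have hN : N ∈ T := by simp [hTe]
  have hP : P ∈ T := by simp [hTe]
  have hQ : Q ∈ T := by simp [hTe]
  have : bary T N + bary T P + bary T Q = AffineMap.const ℝ Pt 1 := by
    refine affineMap_ext hT fun R hR => ?_
    have hR' : R = N ∨ R = P ∨ R = Q := by simpa [hTe] using hR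
    rcases hR' with rfl | rfl | rfl <;>
      simp [bary_apply hT, hN, hP, hQ, hNP, hNQ, hPQ, hNP.symm, hNQ.symm, hPQ.symm]
  simpa using congrArg (fun a : Pt →ᵃ[ℝ] ℝ => a x) this

theorem affineMap_apply_lineMap (a : Pt →ᵃ[ℝ] ℝ) (x y : Pt) (t : ℝ) :
    a (AffineMap.lineMap x y t) = (1 - t) * a x + t * a y := by
  rw [AffineMap.apply_lineMap, AffineMap.lineMap_apply_module]; simp

end Triangle

section Triangle

open scoped Classical

theorem affineMap_eq_bary {T : Finset Pt} (hT : IsTriangle T) {N P Q : Pt} (hNP : N ≠ P)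
    (hNQ : N ≠ Q) (hPQ : P ≠ Q) (hTe : T = {N, P, Q}) (a : Pt →ᵃ[ℝ] ℝ) (x : Pt) :
    a x = a N * bary T N x + a P * bary T P x + a Q * bary T Q x := by
  have hN : N ∈ T := by simp [hTe]
  have hP : P ∈ T := by simp [hTe]
  have hQ : Q ∈ T := by simp [hTe]
  have : a = a N • bary T N + a P • bary T P + a Q • bary T Q := by
    refine affineMap_ext hT fun R hR => ?_
    have hR' : R = N ∨ R = P ∨ R = Q := by simpa [hTe] using hR
    rcases hR' with rfl | rfl | rfl <;>
      simp [bary_apply hT, hN, hP, hQ, hNP, hNQ, hPQ, hNP.symm, hNQ.symm, hPQ.symm]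
  simpa using congrArg (fun a : Pt →ᵃ[ℝ] ℝ => a x) this

theorem eq_of_bary_eq {T : Finset Pt} (hT : IsTriangle T) {x y : Pt}
    (h : ∀ P ∈ T, bary T P x = bary T P y) : x = y :=
  hT.basis.ext_elem fun P => by rw [← bary_eq_coord hT]; exact h P P.2

theorem IsTriangle.exists_opposite {T : Finset Pt} (hT : IsTriangle T) {N P : Pt} (hNP : N ≠ P)
    (hF : {N, P} ⊆ T) : ∃ Q, N ≠ Q ∧ P ≠ Q ∧ T = {N, P, Q} := by
  obtain ⟨P', Q, h1, h2, h3, h4, h5⟩ :=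
    hT.exists_third hF (Finset.card_pair hNP) (N := N) (by simp)
  have : P' ∈ ({N, P} : Finset Pt) := by rw [h5]; simp
  have hP : P' = P := by
    rcases Finset.mem_insert.1 this with h | h
    · exact absurd h.symm h1
    · exact Finset.mem_singleton.1 h
  subst hP
  exact ⟨Q, h2, h3, h4⟩

/-- The cone with apex `N` spanned by the triangle `T`. -/
def cone (T : Finset Pt) (N : Pt) : Set Pt := {x | ∀ P ∈ T, P ≠ N → 0 ≤ bary T P x}

theorem isClosed_cone (T : Finset Pt) (N : Pt) : IsClosed (cone T N) := by
  have : cone T N = ⋂ P ∈ T, ⋂ _ : P ≠ N, {x | 0 ≤ bary T P x} := by ext; simp [cone]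
  rw [this]
  exact isClosed_biInter fun P _ => isClosed_iInter fun _ =>
    isClosed_le continuous_const (bary T P).continuous_real

theorem mem_hull_of_mem_cone {T : Finset Pt} (hT : IsTriangle T) {N x : Pt} (hx : x ∈ cone T N)
    (h : 0 ≤ bary T N x) : x ∈ hull T :=
  (mem_hull_iff hT).2 fun P hP => by
    by_cases hPN : P = N
    · rwa [hPN]
    · exact hx P hP hPN

theorem eventually_pos_lineMap (a : Pt →ᵃ[ℝ] ℝ) {x : Pt} (y : Pt) (h : 0 < a x) :
    ∀ᶠ t in 𝓝[>] (0 : ℝ), 0 < a (AffineMap.lineMap x y t) := by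
  have hc : Continuous fun t : ℝ => a (AffineMap.lineMap x y t) :=
    a.continuous_real.comp AffineMap.lineMap_continuous
  refine nhdsWithin_le_nhds (hc.continuousAt.eventually (lt_mem_nhds ?_))
  simpa using h

end Triangle

/-! ### Conforming meshes: adjacent triangles and the edges around a node -/

namespace TriMesh

open scoped Classical

variable {𝒯 : TriMesh}

theorem isTriangle {T : Finset Pt} (hT : T ∈ 𝒯.cells) : IsTriangle T :=
  ⟨𝒯.card_cell T hT, 𝒯.nondegenerate T hT⟩

theorem mem_edges_iff {F : Finset Pt} : F ∈ 𝒯.edges ↔ F.card = 2 ∧ ∃ T ∈ 𝒯.cells, F ⊆ T := by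
  simp only [edges, Finset.mem_biUnion, Finset.mem_powersetCard]
  tauto

/-- The form in which conformity is used throughout: the intersection lies in the hull of the common
vertices, and there the coordinate of a vertex outside `T'` vanishes. -/
theorem mem_of_bary_ne_zero {T T' : Finset Pt} (hT : T ∈ 𝒯.cells) (hT' : T' ∈ 𝒯.cells) {P x : Pt}
    (hP : P ∈ T) (hx : x ∈ hull T) (hx' : x ∈ hull T') (h : bary T P x ≠ 0) : P ∈ T' := by
  by_contra hP'
  refine h (eq_zero_on_convexHull _ (fun y hy => ?_) (𝒯.conforming T hT T' hT' ⟨hx, hx'⟩))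
  rw [bary_apply (isTriangle hT) hP hy.1, if_neg]
  rintro rfl
  exact hP' hy.2

/-- Two triangles with a common edge lie on opposite sides of it. -/
theorem bary_opposite_neg {T T' : Finset Pt} (hT : T ∈ 𝒯.cells) (hT' : T' ∈ 𝒯.cells)
    {N P Q R : Pt} (hNP : N ≠ P) (hNQ : N ≠ Q) (hPQ : P ≠ Q) (hNR : N ≠ R) (hPR : P ≠ R)
    (hQR : Q ≠ R) (hTe : T = {N, P, Q}) (hTe' : T' = {N, P, R}) : bary T Q R < 0 := by
  by_contra! h
  have t := isTriangle hT
  have t' := isTriangle hT'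
  have hN : N ∈ T := by simp [hTe]
  have hP : P ∈ T := by simp [hTe]
  have hQ : Q ∈ T := by simp [hTe]
  have hN' : N ∈ T' := by simp [hTe']
  have hP' : P ∈ T' := by simp [hTe']
  have hR' : R ∈ T' := by simp [hTe']
  set m : Pt := AffineMap.lineMap N P (1 / 2 : ℝ) with hm
  have e1 : 0 < bary T N m := by
    rw [hm, affineMap_apply_lineMap, bary_apply t hN hN, bary_apply t hN hP]; norm_num [hNP]
  have e2 : 0 < bary T P m := by
    rw [hm, affineMap_apply_lineMap, bary_apply t hP hN, bary_apply t hP hP]; norm_num [hNP.symm]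
  have e3 : bary T Q m = 0 := by
    rw [hm, affineMap_apply_lineMap, bary_apply t hQ hN, bary_apply t hQ hP]
    simp [hNQ.symm, hPQ.symm]
  have e4 : bary T' N m = 1 / 2 := by
    rw [hm, affineMap_apply_lineMap, bary_apply t' hN' hN', bary_apply t' hN' hP']
    norm_num [hNP]
  have e5 : bary T' P m = 1 / 2 := by
    rw [hm, affineMap_apply_lineMap, bary_apply t' hP' hN', bary_apply t' hP' hP']
    norm_num [hNP.symm]
  have e6 : bary T' R m = 0 := by
    rw [hm, affineMap_apply_lineMap, bary_apply t' hR' hN', bary_apply t' hR' hP']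
    simp [hNR.symm, hPR.symm]
  have h01 : ∀ᶠ ε in 𝓝[>] (0 : ℝ), ε ∈ Set.Ioo (0 : ℝ) 1 := Ioo_mem_nhdsGT one_pos
  obtain ⟨ε, h1, h2, hε0, hε1⟩ := ((eventually_pos_lineMap _ R e1).and
    ((eventually_pos_lineMap _ R e2).and h01)).exists
  have hy : AffineMap.lineMap m R ε ∈ hull T := by
    rw [mem_hull_iff t, hTe]
    simp only [Finset.mem_insert, Finset.mem_singleton, forall_eq_or_imp, forall_eq]
    rw [← hTe]
    refine ⟨h1.le, h2.le, ?_⟩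
    rw [affineMap_apply_lineMap, e3]
    nlinarith
  have e7 : bary T' R (AffineMap.lineMap m R ε) = ε := by
    rw [affineMap_apply_lineMap, e6, bary_apply t' hR' hR']; simp
  have hy' : AffineMap.lineMap m R ε ∈ hull T' := by
    rw [mem_hull_iff t', hTe']
    simp only [Finset.mem_insert, Finset.mem_singleton, forall_eq_or_imp, forall_eq]
    rw [← hTe']
    refine ⟨?_, ?_, by rw [e7]; exact hε0.le⟩
    · rw [affineMap_apply_lineMap, e4, bary_apply t' hN' hR', if_neg hNR]; linarith
    · rw [affineMap_apply_lineMap, e5, bary_apply t' hP' hR', if_neg hPR]; linarith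
  have := mem_of_bary_ne_zero hT' hT hR' hy' hy (by rw [e7]; exact hε0.ne')
  rw [hTe] at this
  simp [hNR.symm, hPR.symm, hQR.symm] at this

/-- Both coordinates vanish on the line through `N` and `P`, so they are proportional; evaluation at
`R` gives the factor. -/
theorem bary_opposite_eq_mul {T T' : Finset Pt} (hT : T ∈ 𝒯.cells) (hT' : T' ∈ 𝒯.cells)
    {N P Q R : Pt} (hNP : N ≠ P) (hNQ : N ≠ Q) (hPQ : P ≠ Q) (hNR : N ≠ R) (hPR : P ≠ R)
    (hTe : T = {N, P, Q}) (hTe' : T' = {N, P, R}) (x : Pt) :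
    bary T Q x = bary T Q R * bary T' R x := by
  rw [affineMap_eq_bary (isTriangle hT') hNP hNR hPR hTe' (bary T Q) x,
    bary_apply (isTriangle hT) (by simp [hTe]) (by simp [hTe]),
    bary_apply (isTriangle hT) (by simp [hTe]) (by simp [hTe])]
  simp [hNQ.symm, hPQ.symm]

/-- An edge belongs to at most two triangles. -/
theorem card_cells_of_edge_le_two {F : Finset Pt} (hF : F.card = 2) :
    (𝒯.cells.filter (F ⊆ ·)).card ≤ 2 := by
  obtain ⟨N, P, hNP, rfl⟩ := Finset.card_eq_two.1 hF
  by_contra! h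
  obtain ⟨T₁, h1, T₂, h2, T₃, h3, h12, h13, h23⟩ := Finset.two_lt_card.1 h
  rw [Finset.mem_filter] at h1 h2 h3
  obtain ⟨Q, hNQ, hPQ, e1⟩ := (isTriangle h1.1).exists_opposite hNP h1.2
  obtain ⟨R, hNR, hPR, e2⟩ := (isTriangle h2.1).exists_opposite hNP h2.2
  obtain ⟨Z, hNZ, hPZ, e3⟩ := (isTriangle h3.1).exists_opposite hNP h3.2
  have hQR : Q ≠ R := by rintro rfl; exact h12 (e1.trans e2.symm)
  have hQZ : Q ≠ Z := by rintro rfl; exact h13 (e1.trans e3.symm)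
  have hRZ : R ≠ Z := by rintro rfl; exact h23 (e2.trans e3.symm)
  have a1 := bary_opposite_neg h1.1 h2.1 hNP hNQ hPQ hNR hPR hQR e1 e2
  have a2 := bary_opposite_neg h1.1 h3.1 hNP hNQ hPQ hNZ hPZ hQZ e1 e3
  have a3 := bary_opposite_neg h2.1 h3.1 hNP hNR hPR hNZ hPZ hRZ e2 e3
  have a4 := bary_opposite_eq_mul h1.1 h2.1 hNP hNQ hPQ hNR hPR e1 e2 Z
  -- Three opposite vertices would lie pairwise on opposite sides of one line: `a4` writes a
  -- negative number as a product of two negative ones.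
  nlinarith

/-- Near `x`, only the triangles that contain `x` matter. -/
theorem eventually_mem_hull (𝒯 : TriMesh) (x : Pt) :
    ∀ᶠ y in 𝓝 x, ∀ T ∈ 𝒯.cells, y ∈ hull T → x ∈ hull T := by
  rw [Filter.eventually_all_finset]
  intro T _
  by_cases hx : x ∈ hull T
  · exact Filter.Eventually.of_forall fun _ _ => hx
  · filter_upwards [(isClosed_hull T).isOpen_compl.mem_nhds hx] with y hy hy'
    exact absurd hy' hy

/-- An edge that meets an open subset of the domain is not a boundary edge. -/
theorem not_isBoundaryEdge_of_inter_nonempty {F : Finset Pt} {U : Set Pt} (hU : IsOpen U)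
    (hUD : U ⊆ 𝒯.domain) (h : (hull F ∩ U).Nonempty) : ¬ 𝒯.IsBoundaryEdge F := by
  rintro ⟨hF, hcard⟩
  obtain ⟨hF2, T, hT, hFT⟩ := mem_edges_iff.1 hF
  obtain ⟨N, P, hNP, rfl⟩ := Finset.card_eq_two.1 hF2
  have t := isTriangle hT
  obtain ⟨Q, hNQ, hPQ, hTe⟩ := t.exists_opposite hNP hFT
  obtain ⟨x₀, hx₀, hxU⟩ := h
  have hN : N ∈ T := by simp [hTe]
  have hP : P ∈ T := by simp [hTe]
  have hQ : Q ∈ T := by simp [hTe]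
  have hsub : ∀ x ∈ hull {N, P}, x ∈ hull T := fun x hx =>
    convexHull_mono (by exact_mod_cast hFT) hx
  have hQ0 : ∀ x ∈ hull {N, P}, bary T Q x = 0 := fun x hx => by
    refine eq_zero_on_convexHull _ (fun y hy => ?_) hx
    have hy' : y = N ∨ y = P := by simpa using hy
    rcases hy' with rfl | rfl
    · rw [bary_apply t hQ hN, if_neg hNQ.symm]
    · rw [bary_apply t hQ hP, if_neg hPQ.symm]
  have hNF : N ∈ hull {N, P} := subset_convexHull _ _ (by simp)
  have hPF : P ∈ hull {N, P} := subset_convexHull _ _ (by simp)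
  -- The given point may be an endpoint of the edge; a nudge towards the midpoint, staying in `U`,
  -- makes both coordinates along the edge positive.
  set m : Pt := AffineMap.lineMap N P (1 / 2 : ℝ) with hm
  have hmF : m ∈ hull {N, P} :=
    (convex_convexHull ℝ _).lineMap_mem hNF hPF ⟨by norm_num, by norm_num⟩
  have e1 : bary T N m = 1 / 2 := by
    rw [hm, affineMap_apply_lineMap, bary_apply t hN hN, bary_apply t hN hP]; norm_num [hNP]
  have e2 : bary T P m = 1 / 2 := by
    rw [hm, affineMap_apply_lineMap, bary_apply t hP hN, bary_apply t hP hP]; norm_num [hNP.symm]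
  have hlm : Continuous fun ε : ℝ => AffineMap.lineMap x₀ m ε := AffineMap.lineMap_continuous
  have hev : ∀ᶠ ε in 𝓝[>] (0 : ℝ), AffineMap.lineMap x₀ m ε ∈ U :=
    nhdsWithin_le_nhds (hlm.continuousAt.eventually (hU.mem_nhds (by simpa using hxU)))
  have h01 : ∀ᶠ ε in 𝓝[>] (0 : ℝ), ε ∈ Set.Ioo (0 : ℝ) 1 := Ioo_mem_nhdsGT one_pos
  obtain ⟨ε, hεU, hε0, hε1⟩ := (hev.and h01).exists
  set x : Pt := AffineMap.lineMap x₀ m ε with hx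
  have hxF : x ∈ hull {N, P} := (convex_convexHull ℝ _).lineMap_mem hx₀ hmF ⟨hε0.le, hε1.le⟩
  have hxT := hsub x hxF
  have hx₀T := (mem_hull_iff t).1 (hsub x₀ hx₀)
  have hNx : bary T N x ≠ 0 := by
    have := hx₀T N hN
    rw [hx, affineMap_apply_lineMap, e1]
    nlinarith
  have hPx : bary T P x ≠ 0 := by
    have := hx₀T P hP
    rw [hx, affineMap_apply_lineMap, e2]
    nlinarith
  -- The negative parameter moves away from `Q`, out of `T`. The new point is still in the domain,
  -- so some triangle contains it; conformity gives that triangle the edge `{N, P}`, and a boundary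
  -- edge has no triangle but `T`.
  have hlm' : Continuous fun δ : ℝ => AffineMap.lineMap x Q (-δ) :=
    AffineMap.lineMap_continuous.comp continuous_neg
  have hev1 : ∀ᶠ δ in 𝓝[>] (0 : ℝ), AffineMap.lineMap x Q (-δ) ∈ U :=
    nhdsWithin_le_nhds (hlm'.continuousAt.eventually (hU.mem_nhds (by simpa using hεU)))
  have hev2 : ∀ᶠ δ in 𝓝[>] (0 : ℝ), ∀ T ∈ 𝒯.cells,
      AffineMap.lineMap x Q (-δ) ∈ hull T → x ∈ hull T :=
    ((hlm'.tendsto' 0 x (by simp)).eventually (𝒯.eventually_mem_hull x)).filter_mono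
      nhdsWithin_le_nhds
  obtain ⟨δ, hδU, hδT, hδ0, hδ1⟩ := (hev1.and (hev2.and h01)).exists
  have hyU := interior_subset (hUD hδU)
  simp only [Set.mem_iUnion] at hyU
  obtain ⟨T', hT', hy⟩ := hyU
  have hxT' := hδT T' hT' hy
  have hN' := mem_of_bary_ne_zero hT hT' hN hxT hxT' hNx
  have hP' := mem_of_bary_ne_zero hT hT' hP hxT hxT' hPx
  have hTT' : T' = T := by
    obtain ⟨T₀, hT₀⟩ := Finset.card_eq_one.1 hcard
    have a1 : T ∈ ({T₀} : Finset _) := hT₀ ▸ Finset.mem_filter.2 ⟨hT, hFT⟩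
    have a2 : T' ∈ ({T₀} : Finset _) := hT₀ ▸ Finset.mem_filter.2
      ⟨hT', by simp [Finset.insert_subset_iff, hN', hP']⟩
    rw [Finset.mem_singleton] at a1 a2
    rw [a1, a2]
  subst hTT'
  have := (mem_hull_iff t).1 hy Q hQ
  rw [affineMap_apply_lineMap, hQ0 x hxF, bary_apply t hQ hQ, if_pos rfl] at this
  linarith

/-- A set of edges at the node `N` that contains, with an edge `F` of a triangle `T`, the other
edge of `T` at `N`. -/
structure IsSaturated (𝒯 : TriMesh) (N : Pt) (A : Set (Finset Pt)) : Prop where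
  mem : ∀ F ∈ A, F ∈ 𝒯.edges ∧ N ∈ F
  closed : ∀ F ∈ A, ∀ T ∈ 𝒯.cells, F ⊆ T → ∀ E ⊆ T, E.card = 2 → N ∈ E → E ∈ A

/-- The triangles with an edge in `A`. -/
noncomputable def cellsAlong (𝒯 : TriMesh) (A : Set (Finset Pt)) : Finset (Finset Pt) :=
  𝒯.cells.filter fun T => ∃ F ∈ A, F ⊆ T

variable {N : Pt} {A : Set (Finset Pt)}

theorem mem_cellsAlong {T : Finset Pt} :
    T ∈ 𝒯.cellsAlong A ↔ T ∈ 𝒯.cells ∧ ∃ F ∈ A, F ⊆ T := Finset.mem_filter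

theorem IsSaturated.mem_of_mem_cellsAlong (hA : 𝒯.IsSaturated N A) {T : Finset Pt}
    (hT : T ∈ 𝒯.cellsAlong A) : N ∈ T := by
  obtain ⟨-, F, hF, hFT⟩ := mem_cellsAlong.1 hT
  exact hFT (hA.mem F hF).2

theorem IsSaturated.edge_mem (hA : 𝒯.IsSaturated N A) {T F : Finset Pt}
    (hT : T ∈ 𝒯.cellsAlong A) (hF : F ⊆ T) (hF2 : F.card = 2) (hN : N ∈ F) : F ∈ A := by
  obtain ⟨hTc, F', hF', hFT⟩ := mem_cellsAlong.1 hT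
  exact hA.closed F' hF' T hTc hFT F hF hF2 hN

theorem exists_ne_of_not_isBoundaryEdge {F T : Finset Pt} (hF : F ∈ 𝒯.edges)
    (hb : ¬ 𝒯.IsBoundaryEdge F) (hT : T ∈ 𝒯.cells) (hFT : F ⊆ T) :
    ∃ T' ∈ 𝒯.cells, F ⊆ T' ∧ T' ≠ T := by
  by_contra! h
  refine hb ⟨hF, Finset.card_eq_one.2 ⟨T, ?_⟩⟩
  ext T'
  simp only [Finset.mem_filter, Finset.mem_singleton]
  exact ⟨fun h' => h T' h'.1 h'.2, by rintro rfl; exact ⟨hT, hFT⟩⟩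

/-- At a point of the ray carried by an interior edge, the two adjacent triangles cover the two
sides of the ray. The second one is also along `A`, because the edge belongs to `A`. -/
theorem IsSaturated.cones_mem_nhds_edge (hA : 𝒯.IsSaturated N A)
    (hb : ∀ F ∈ A, ¬ 𝒯.IsBoundaryEdge F) {T : Finset Pt} (hT : T ∈ 𝒯.cellsAlong A) {P Q : Pt}
    (hNP : N ≠ P) (hNQ : N ≠ Q) (hPQ : P ≠ Q) (hTe : T = {N, P, Q}) {x : Pt}
    (hP : 0 < bary T P x) (hQ : bary T Q x = 0) :
    (⋃ T ∈ 𝒯.cellsAlong A, cone T N) ∈ 𝓝 x := by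
  have hTc := (mem_cellsAlong.1 hT).1
  have t := isTriangle hTc
  have hFA : {N, P} ∈ A := hA.edge_mem hT (by simp [hTe, Finset.insert_subset_iff])
    (Finset.card_pair hNP) (by simp)
  obtain ⟨T', hTc', hFT', hne⟩ := exists_ne_of_not_isBoundaryEdge (hA.mem _ hFA).1 (hb _ hFA) hTc
    (by simp [hTe, Finset.insert_subset_iff])
  have hT' : T' ∈ 𝒯.cellsAlong A := mem_cellsAlong.2 ⟨hTc', _, hFA, hFT'⟩
  have t' := isTriangle hTc'
  obtain ⟨R, hNR, hPR, hTe'⟩ := t'.exists_opposite hNP hFT'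
  have hQR : Q ≠ R := by rintro rfl; exact hne (hTe'.trans hTe.symm)
  have hneg := bary_opposite_neg hTc hTc' hNP hNQ hPQ hNR hPR hQR hTe hTe'
  have hP' : 0 < bary T' P x := by
    rw [affineMap_eq_bary t hNP hNQ hPQ hTe (bary T' P) x, hQ,
      bary_apply t' (by simp [hTe']) (by simp [hTe']),
      bary_apply t' (by simp [hTe']) (by simp [hTe'])]
    simpa [hNP.symm] using hP
  filter_upwards [(bary T P).continuous_real.continuousAt.eventually (lt_mem_nhds hP),
    (bary T' P).continuous_real.continuousAt.eventually (lt_mem_nhds hP')] with y hy hy'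
  simp only [Set.mem_iUnion]
  by_cases hs : 0 ≤ bary T Q y
  · refine ⟨T, hT, fun V hV hVN => ?_⟩
    have : V = N ∨ V = P ∨ V = Q := by simpa [hTe] using hV
    rcases this with rfl | rfl | rfl
    · exact absurd rfl hVN
    · exact hy.le
    · exact hs
  · refine ⟨T', hT', fun V hV hVN => ?_⟩
    have : V = N ∨ V = P ∨ V = R := by simpa [hTe'] using hV
    rcases this with rfl | rfl | rfl
    · exact absurd rfl hVN
    · exact hy'.le
    · rw [bary_opposite_eq_mul hTc hTc' hNP hNQ hPQ hNR hPR hTe hTe' y] at hs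
      by_contra! h
      exact hs (mul_nonneg_of_nonpos_of_nonpos hneg.le h.le)

/-- Away from the apex the union of the cones is open: a point is either inside one cone or on a ray
shared by two. Only the apex has both coordinates equal to zero. -/
theorem IsSaturated.cones_mem_nhds (hA : 𝒯.IsSaturated N A)
    (hb : ∀ F ∈ A, ¬ 𝒯.IsBoundaryEdge F) {x : Pt} (hxN : x ≠ N)
    (hx : x ∈ ⋃ T ∈ 𝒯.cellsAlong A, cone T N) :
    (⋃ T ∈ 𝒯.cellsAlong A, cone T N) ∈ 𝓝 x := by
  simp only [Set.mem_iUnion] at hx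
  obtain ⟨T, hT, hx⟩ := hx
  have t := isTriangle (mem_cellsAlong.1 hT).1
  obtain ⟨P, Q, hNP, hNQ, hPQ, hTe⟩ := t.exists_vertices (hA.mem_of_mem_cellsAlong hT)
  have hP := hx P (by simp [hTe]) hNP.symm
  have hQ := hx Q (by simp [hTe]) hNQ.symm
  rcases hP.eq_or_lt with hP | hP
  · rcases hQ.eq_or_lt with hQ | hQ
    · have hsum := bary_add_bary_add_bary t hNP hNQ hPQ hTe x
      refine absurd (eq_of_bary_eq t (y := N) fun V hV => ?_) hxN
      have hV' : V = N ∨ V = P ∨ V = Q := by simpa [hTe] using hV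
      rw [bary_apply t hV (hA.mem_of_mem_cellsAlong hT)]
      rcases hV' with rfl | rfl | rfl
      · rw [if_pos rfl]; linarith
      · rw [if_neg hNP.symm, ← hP]
      · rw [if_neg hNQ.symm, ← hQ]
    · exact hA.cones_mem_nhds_edge hb hT hNQ hNP hPQ.symm (by rw [hTe]; ext; simp; tauto) hQ hP.symm
  · rcases hQ.eq_or_lt with hQ | hQ
    · exact hA.cones_mem_nhds_edge hb hT hNP hNQ hPQ hTe hP hQ.symm
    · filter_upwards [(bary T P).continuous_real.continuousAt.eventually (lt_mem_nhds hP),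
        (bary T Q).continuous_real.continuousAt.eventually (lt_mem_nhds hQ)] with y hy hy'
      simp only [Set.mem_iUnion]
      refine ⟨T, hT, fun V hV hVN => ?_⟩
      have : V = N ∨ V = P ∨ V = Q := by simpa [hTe] using hV
      rcases this with rfl | rfl | rfl
      · exact absurd rfl hVN
      · exact hy.le
      · exact hy'.le

/-- The triangles along a saturated set of interior edges go all the way around the node. -/
theorem IsSaturated.exists_mem_cone (hA : 𝒯.IsSaturated N A) (hne : A.Nonempty)
    (hb : ∀ F ∈ A, ¬ 𝒯.IsBoundaryEdge F) (x : Pt) : ∃ T ∈ 𝒯.cellsAlong A, x ∈ cone T N := by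
  obtain ⟨F, hF⟩ := hne
  obtain ⟨-, T, hT, hFT⟩ := mem_edges_iff.1 (hA.mem F hF).1
  have hTA : T ∈ 𝒯.cellsAlong A := mem_cellsAlong.2 ⟨hT, F, hF, hFT⟩
  have t := isTriangle hT
  have hvert : ∀ V ∈ T, V ∈ cone T N := fun V hV P hP _ => by
    rw [bary_apply t hP hV]; split_ifs <;> norm_num
  obtain ⟨P, Q, hNP, hNQ, hPQ, hTe⟩ := t.exists_vertices (hA.mem_of_mem_cellsAlong hTA)
  by_cases hxN : x = N
  · exact ⟨T, hTA, hvert x (by simp [hTe, hxN])⟩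
  set W := ⋃ T ∈ 𝒯.cellsAlong A, cone T N with hW
  have hclosed : IsClosed W := isClosed_biUnion_finset fun T _ => isClosed_cone T N
  have hrank : 1 < Module.rank ℝ Pt := by
    rw [← Module.finrank_eq_rank]; simp
  -- The punctured plane is connected, and in it the closed set `W` is also open and non-empty.
  have hsub : ({N}ᶜ : Set Pt) ⊆ interior W := by
    refine (isConnected_compl_singleton_of_one_lt_rank hrank N).isPreconnected
      |>.subset_of_closure_inter_subset isOpen_interior ⟨P, ?_, ?_⟩ ?_
    · exact hNP.symm
    · exact mem_interior_iff_mem_nhds.2 (hA.cones_mem_nhds hb hNP.symm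
        (Set.mem_biUnion hTA (hvert P (by simp [hTe]))))
    · rintro y ⟨hy, hyN⟩
      exact mem_interior_iff_mem_nhds.2 (hA.cones_mem_nhds hb hyN
        (closure_minimal interior_subset hclosed hy))
  have := interior_subset (hsub hxN)
  simp only [hW, Set.mem_iUnion] at this
  obtain ⟨T', h1, h2⟩ := this
  exact ⟨T', h1, h2⟩

/-- Near `N` the coordinate of `N` is positive in each of these triangles, so there the cones
coincide with the triangles. -/
theorem IsSaturated.eventually_exists_mem_hull (hA : 𝒯.IsSaturated N A) (hne : A.Nonempty)
    (hb : ∀ F ∈ A, ¬ 𝒯.IsBoundaryEdge F) :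
    ∀ᶠ y in 𝓝 N, ∃ T ∈ 𝒯.cellsAlong A, y ∈ hull T := by
  have hpos : ∀ᶠ y in 𝓝 N, ∀ T ∈ 𝒯.cellsAlong A, 0 < bary T N y := by
    rw [Filter.eventually_all_finset]
    intro T hT
    have hN := hA.mem_of_mem_cellsAlong hT
    refine (bary T N).continuous_real.continuousAt.eventually (lt_mem_nhds ?_)
    rw [bary_apply (isTriangle (mem_cellsAlong.1 hT).1) hN hN, if_pos rfl]
    exact one_pos
  filter_upwards [hpos] with y hy
  obtain ⟨T, hT, hyT⟩ := hA.exists_mem_cone hne hb y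
  exact ⟨T, hT, mem_hull_of_mem_cone (isTriangle (mem_cellsAlong.1 hT).1) hyT (hy T hT).le⟩

/-- Points of `F` close to `N` lie in a triangle along `A`; conformity makes the other endpoint of
`F` a vertex of it, and saturation puts `F` into `A`. -/
theorem IsSaturated.mem_of_interior (hA : 𝒯.IsSaturated N A) (hne : A.Nonempty)
    (hb : ∀ F ∈ A, ¬ 𝒯.IsBoundaryEdge F) {F : Finset Pt} (hF : F ∈ 𝒯.edges) (hN : N ∈ F) :
    F ∈ A := by
  obtain ⟨hF2, T', hT', hFT'⟩ := mem_edges_iff.1 hF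
  have t' := isTriangle hT'
  obtain ⟨M, Q, hNM, hNQ, hMQ, hTe', rfl⟩ := t'.exists_third hFT' hF2 hN
  have hlm : Continuous fun ε : ℝ => AffineMap.lineMap N M ε := AffineMap.lineMap_continuous
  have hev : ∀ᶠ ε in 𝓝[>] (0 : ℝ), ∃ T ∈ 𝒯.cellsAlong A, AffineMap.lineMap N M ε ∈ hull T :=
    ((hlm.tendsto' 0 N (by simp)).eventually
      (hA.eventually_exists_mem_hull hne hb)).filter_mono nhdsWithin_le_nhds
  have h01 : ∀ᶠ ε in 𝓝[>] (0 : ℝ), ε ∈ Set.Ioo (0 : ℝ) 1 := Ioo_mem_nhdsGT one_pos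
  obtain ⟨ε, ⟨T, hT, hy⟩, hε0, hε1⟩ := (hev.and h01).exists
  have hN' : N ∈ T' := by simp [hTe']
  have hM' : M ∈ T' := by simp [hTe']
  have hy' : AffineMap.lineMap N M ε ∈ hull T' := (convex_convexHull ℝ _).lineMap_mem
    (subset_convexHull _ _ hN') (subset_convexHull _ _ hM') ⟨hε0.le, hε1.le⟩
  have hM : M ∈ T := by
    refine mem_of_bary_ne_zero hT' (mem_cellsAlong.1 hT).1 hM' hy' hy ?_
    rw [affineMap_apply_lineMap, bary_apply t' hM' hN', bary_apply t' hM' hM', if_neg hNM.symm]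
    simpa using hε0.ne'
  exact hA.edge_mem hT
    (by simp [Finset.insert_subset_iff, hM, hA.mem_of_mem_cellsAlong hT]) hF2 hN

/-- Double counting of incidences between edges in `A` and triangles: a triangle contributes two
edges or none, while an edge has two triangles, or one if it is on the boundary. -/
theorem IsSaturated.even_card_boundary (hA : 𝒯.IsSaturated N A) :
    Even (𝒯.edges.filter fun F => F ∈ A ∧ 𝒯.IsBoundaryEdge F).card := by
  set E := 𝒯.edges.filter (· ∈ A) with hE
  have hcount : ∑ F ∈ E, (𝒯.cells.filter (F ⊆ ·)).card
      = ∑ T ∈ 𝒯.cells, (E.filter (· ⊆ T)).card := by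
    simp_rw [Finset.card_filter]
    exact Finset.sum_comm
  have heven : Even (∑ T ∈ 𝒯.cells, (E.filter (· ⊆ T)).card) := by
    refine Finset.even_sum _ fun T hT => ?_
    by_cases h : ∃ F ∈ A, F ⊆ T
    · have hTA : T ∈ 𝒯.cellsAlong A := mem_cellsAlong.2 ⟨hT, h⟩
      have t := isTriangle hT
      have hN := hA.mem_of_mem_cellsAlong hTA
      obtain ⟨P, Q, hNP, hNQ, hPQ, hTe⟩ := t.exists_vertices hN
      have : E.filter (· ⊆ T) = {{N, P}, {N, Q}} := by
        ext F
        simp only [hE, Finset.mem_filter, Finset.mem_insert, Finset.mem_singleton]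
        constructor
        · rintro ⟨⟨hF, hFA⟩, hFT⟩
          obtain ⟨P', Q', h1, h2, h3, h4, rfl⟩ :=
            t.exists_third hFT (mem_edges_iff.1 hF).1 (hA.mem F hFA).2
          have : P' ∈ T := by simp [h4]
          have : P' = N ∨ P' = P ∨ P' = Q := by simpa [hTe] using this
          rcases this with rfl | rfl | rfl
          · exact absurd rfl h1
          · exact Or.inl rfl
          · exact Or.inr rfl
        · intro hF
          have hF' : F ⊆ T ∧ F.card = 2 ∧ N ∈ F := by
            rcases hF with rfl | rfl
            · exact ⟨by simp [hTe, Finset.insert_subset_iff], Finset.card_pair hNP, by simp⟩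
            · exact ⟨by simp [hTe, Finset.insert_subset_iff], Finset.card_pair hNQ, by simp⟩
          exact ⟨⟨mem_edges_iff.2 ⟨hF'.2.1, T, hT, hF'.1⟩,
            hA.edge_mem hTA hF'.1 hF'.2.1 hF'.2.2⟩, hF'.1⟩
      rw [this, Finset.card_pair]
      · exact even_two
      · intro h
        have : P ∈ ({N, Q} : Finset Pt) := h ▸ by simp
        simp [hNP.symm, hPQ] at this
    · rw [Finset.card_eq_zero.2]
      · exact Even.zero
      · refine Finset.filter_eq_empty_iff.2 fun F hF hFT => h ⟨F, ?_, hFT⟩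
        exact (Finset.mem_filter.1 hF).2
  have hdeg : ∀ F ∈ E, (𝒯.cells.filter (F ⊆ ·)).card
      + (if 𝒯.IsBoundaryEdge F then 1 else 0) = 2 := by
    intro F hF
    have hF' := (Finset.mem_filter.1 hF).1
    obtain ⟨hF2, T, hT, hFT⟩ := mem_edges_iff.1 hF'
    have h2 := card_cells_of_edge_le_two (𝒯 := 𝒯) hF2
    have h1 : 0 < (𝒯.cells.filter (F ⊆ ·)).card :=
      Finset.card_pos.2 ⟨T, Finset.mem_filter.2 ⟨hT, hFT⟩⟩
    split_ifs with hb
    · have := hb.2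
      omega
    · have : (𝒯.cells.filter (F ⊆ ·)).card ≠ 1 := fun h => hb ⟨hF', h⟩
      omega
  have hsum := Finset.sum_congr rfl hdeg
  rw [Finset.sum_add_distrib, ← Finset.card_filter, hcount, Finset.sum_const, smul_eq_mul,
    hE, Finset.filter_filter] at hsum
  have : Even (∑ T ∈ 𝒯.cells, (E.filter (· ⊆ T)).card
      + (𝒯.edges.filter fun F => F ∈ A ∧ 𝒯.IsBoundaryEdge F).card) := by
    rw [hsum]; exact even_two.mul_left _
  exact (Nat.even_add.1 this).1 heven

/-- If the boundary does not touch itself, a saturated set of edges at a node is empty or the set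
of all edges at that node. -/
theorem IsSaturated.mem_of_simpleBoundary (hS : 𝒯.HasSimpleBoundary) (hA : 𝒯.IsSaturated N A)
    (hne : A.Nonempty) {F : Finset Pt} (hF : F ∈ 𝒯.edges) (hN : N ∈ F) : F ∈ A := by
  by_cases hb : ∀ F ∈ A, ¬ 𝒯.IsBoundaryEdge F
  · exact hA.mem_of_interior hne hb hF hN
  by_contra hFA
  push Not at hb
  obtain ⟨F₀, hF₀, hb₀⟩ := hb
  have hnode : N ∈ 𝒯.nodes := by
    obtain ⟨-, T, hT, hFT⟩ := mem_edges_iff.1 hF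
    exact Finset.mem_biUnion.2 ⟨T, hT, hFT hN⟩
  set B := 𝒯.edges.filter fun F => F ∈ A ∧ 𝒯.IsBoundaryEdge F with hB
  set B' := 𝒯.edges.filter fun F => N ∈ F ∧ 𝒯.IsBoundaryEdge F with hB'
  have hBB' : B ⊆ B' := fun F hF => by
    have := Finset.mem_filter.1 hF
    exact Finset.mem_filter.2 ⟨this.1, (hA.mem F this.2.1).2, this.2.2⟩
  have hpos : 0 < B.card := Finset.card_pos.2 ⟨F₀, Finset.mem_filter.2 ⟨hb₀.1, hF₀, hb₀⟩⟩
  obtain ⟨n, hn⟩ : Even B.card := hA.even_card_boundary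
  -- An even positive number is at least two, and the node has at most two boundary edges, so `A`
  -- contains all of them.
  have hBe : B = B' := Finset.eq_of_subset_of_card_le hBB' ((hS N hnode).trans (by omega))
  -- The edges at `N` outside `A` are again saturated and contain no boundary edge. If there were
  -- any, they would be all the edges at `N`, including `F₀ ∈ A`.
  have hA' : 𝒯.IsSaturated N {F | F ∈ 𝒯.edges ∧ N ∈ F ∧ F ∉ A} := by
    refine ⟨fun F hF => ⟨hF.1, hF.2.1⟩, fun F₁ h₁ T hT h₁T F₂ h₂T hc hN₂ => ?_⟩
    refine ⟨mem_edges_iff.2 ⟨hc, T, hT, h₂T⟩, hN₂, fun h₂A => h₁.2.2 ?_⟩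
    exact hA.closed F₂ h₂A T hT h₂T F₁ h₁T (mem_edges_iff.1 h₁.1).1 h₁.2.1
  have := hA'.mem_of_interior ⟨F, hF, hN, hFA⟩ (fun F₁ h₁ hb₁ => ?_) hb₀.1 (hA.mem F₀ hF₀).2
  · exact this.2.2 hF₀
  · have : F₁ ∈ B := hBe ▸ Finset.mem_filter.2 ⟨h₁.1, h₁.2.1, hb₁⟩
    exact h₁.2.2 (Finset.mem_filter.1 this).2.1

end TriMesh

/-! ### Uniformly bounded solutions of linear systems with entries `0, ±1` -/

section LinearSystem

/-- Data orthogonal to the cokernel lie in the range. A linear right inverse on the range, extended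
to the whole space, is bounded in finite dimension; `C` is its squared operator norm. -/
theorem exists_bounded_solution {ι κ : Type*} [Fintype ι] [Fintype κ] (J : κ → ι → ℝ) :
    ∃ C : ℝ, 0 ≤ C ∧ ∀ g : κ → ℝ,
      (∀ l : κ → ℝ, (∀ t, ∑ F, l F * J F t = 0) → ∑ F, l F * g F = 0) →
      ∃ f : ι → ℝ, (∀ F, ∑ t, J F t * f t = g F) ∧ ∀ t, f t ^ 2 ≤ C * ∑ F, g F ^ 2 := by
  classical
  set L : (ι → ℝ) →ₗ[ℝ] (κ → ℝ) := Matrix.mulVecLin (Matrix.of J) with hL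
  have hLa : ∀ f F, L f F = ∑ t, J F t * f t := fun f F => by
    simp [hL, Matrix.mulVec, dotProduct]
  obtain ⟨R₀, hR₀⟩ := LinearMap.exists_rightInverse_of_surjective L.rangeRestrict
    (LinearMap.range_rangeRestrict L)
  obtain ⟨R, hR⟩ := LinearMap.exists_extend R₀
  set R' : (κ → ℝ) →L[ℝ] (ι → ℝ) := LinearMap.toContinuousLinearMap R with hR'
  refine ⟨‖R'‖ ^ 2, by positivity, fun g hg => ?_⟩
  -- Otherwise a linear functional vanishes on the range but not at `g`; its coefficients form a
  -- cokernel vector that violates the hypothesis.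
  have hmem : g ∈ LinearMap.range L := by
    by_contra hn
    obtain ⟨φ, hφg, hφ⟩ := Submodule.exists_le_ker_of_notMem hn
    have hφe : ∀ y : κ → ℝ, φ y = ∑ F, φ (fun j => if F = j then 1 else 0) * y F := fun y => by
      rw [LinearMap.pi_apply_eq_sum_univ φ y]
      exact Finset.sum_congr rfl fun F _ => by rw [smul_eq_mul, mul_comm]
    refine hφg ?_
    rw [hφe]
    refine hg _ fun t => ?_
    have h0 : φ (L (Pi.single t 1)) = 0 := hφ ⟨_, rfl⟩
    rw [hφe] at h0
    simpa [hLa, Pi.single_apply] using h0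
  refine ⟨R' g, fun F => ?_, fun t => ?_⟩
  · have h1 : R g = R₀ ⟨g, hmem⟩ := by
      rw [← hR]; rfl
    have h2 := LinearMap.congr_fun hR₀ ⟨g, hmem⟩
    have h3 : L (R₀ ⟨g, hmem⟩) = g := congrArg Subtype.val h2
    rw [← hLa, hR', LinearMap.coe_toContinuousLinearMap', h1, h3]
  · have h1 : ‖R' g t‖ ≤ ‖R'‖ * ‖g‖ := (norm_le_pi_norm _ t).trans (R'.le_opNorm g)
    have h2 : ‖g‖ ^ 2 ≤ ∑ F, g F ^ 2 := by
      have : ‖g‖ ≤ √(∑ F, g F ^ 2) := by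
        refine (pi_norm_le_iff_of_nonneg (Real.sqrt_nonneg _)).2 fun F => ?_
        rw [Real.norm_eq_abs]
        exact Real.abs_le_sqrt (Finset.single_le_sum (f := fun F => g F ^ 2)
          (fun _ _ => sq_nonneg _) (Finset.mem_univ F))
      calc ‖g‖ ^ 2 ≤ √(∑ F, g F ^ 2) ^ 2 := by gcongr
        _ = _ := Real.sq_sqrt (Finset.sum_nonneg fun _ _ => sq_nonneg _)
    calc (R' g t) ^ 2 = ‖R' g t‖ ^ 2 := by simp
      _ ≤ (‖R'‖ * ‖g‖) ^ 2 := by gcongr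
      _ = ‖R'‖ ^ 2 * ‖g‖ ^ 2 := by ring
      _ ≤ _ := by gcongr

/-- There are finitely many sign matrices of size at most `K`. After renumbering the index types by
`Fin`, the sum of their individual constants serves for all. -/
theorem exists_uniformly_bounded_solution (K : ℕ) :
    ∃ C : ℝ, 0 ≤ C ∧ ∀ (ι κ : Type) [Fintype ι] [Fintype κ],
      Fintype.card ι ≤ K → Fintype.card κ ≤ K →
      ∀ (J : κ → ι → ℝ), (∀ F t, ∃ s : SignType, J F t = s) → ∀ g : κ → ℝ,
      (∀ l : κ → ℝ, (∀ t, ∑ F, l F * J F t = 0) → ∑ F, l F * g F = 0) →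
      ∃ f : ι → ℝ, (∀ F, ∑ t, J F t * f t = g F) ∧ ∀ t, f t ^ 2 ≤ C * ∑ F, g F ^ 2 := by
  classical
  choose C hC0 hC using fun p : Σ m : Fin (K + 1), Σ n : Fin (K + 1), (Fin n → Fin m → SignType) =>
    exists_bounded_solution fun F t => ((p.2.2 F t : SignType) : ℝ)
  refine ⟨∑ p, C p, Finset.sum_nonneg fun p _ => hC0 p, ?_⟩
  intro ι κ _ _ hι hκ J hJ g hg
  choose s hs using hJ
  set eι := Fintype.equivFin ι
  set eκ := Fintype.equivFin κ
  set p : Σ m : Fin (K + 1), Σ n : Fin (K + 1), (Fin n → Fin m → SignType) :=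
    ⟨⟨Fintype.card ι, by omega⟩, ⟨Fintype.card κ, by omega⟩,
      fun F t => s (eκ.symm F) (eι.symm t)⟩ with hp
  have hps : ∀ F t, p.2.2 (eκ F) (eι t) = s F t := fun F t => by
    change s (eκ.symm (eκ F)) (eι.symm (eι t)) = s F t
    simp
  obtain ⟨f, hf, hfb⟩ := hC p (fun F => g (eκ.symm F)) (by
    intro l hl
    have := hg (fun F => l (eκ F)) (fun t => by
      have := hl (eι t)
      rw [← Equiv.sum_comp eκ] at this
      simpa [hs, hps] using this)
    rw [← Equiv.sum_comp eκ]
    simpa using this)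
  refine ⟨fun t => f (eι t), fun F => ?_, fun t => ?_⟩
  · have := hf (eκ F)
    rw [← Equiv.sum_comp eι] at this
    simpa [hs, hps] using this
  · refine (hfb (eι t)).trans ?_
    rw [← Equiv.sum_comp eκ]
    simp only [Equiv.symm_apply_apply]
    gcongr
    exact Finset.single_le_sum (fun p _ => hC0 p) (Finset.mem_univ p)

end LinearSystem

/-! ### Consequences of shape regularity -/

section Affine

theorem inner_gradient_affineMap (a : Pt →ᵃ[ℝ] ℝ) (x y : Pt) :
    inner ℝ (gradient a x) y = a.linear y := by
  have h : HasFDerivAt a (LinearMap.toContinuousLinearMap a.linear) x := by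
    rw [AffineMap.decomp a]
    exact (LinearMap.toContinuousLinearMap a.linear).hasFDerivAt.add_const _
  rw [gradient, h.fderiv, InnerProductSpace.toDual_symm_apply]
  rfl

/-- From the centre of the disc to its boundary in the direction of the gradient, `a` grows by `r
‖∇a‖`, which is at most `2m`. -/
theorem norm_gradient_le (a : Pt →ᵃ[ℝ] ℝ) {c : Pt} {r m : ℝ} (hr : 0 < r)
    (h : ∀ x ∈ Metric.closedBall c r, |a x| ≤ m) (x : Pt) : ‖gradient a x‖ ≤ 2 * m / r := by
  set g := gradient a x with hg
  by_cases hg0 : g = 0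
  · rw [hg0, norm_zero]
    have := (abs_nonneg _).trans (h c (Metric.mem_closedBall_self hr.le))
    positivity
  have hgn : 0 < ‖g‖ := norm_pos_iff.2 hg0
  have e1 : a (c + (r / ‖g‖) • g) = a c + r * ‖g‖ := by
    rw [add_comm, ← vadd_eq_add, AffineMap.map_vadd, map_smul, ← inner_gradient_affineMap a x, ← hg,
      real_inner_self_eq_norm_sq, vadd_eq_add, smul_eq_mul]
    field_simp
    ring
  have h1 := abs_le.1 (h (c + (r / ‖g‖) • g) (by
    rw [Metric.mem_closedBall, dist_self_add_left, norm_smul, norm_div, norm_norm,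
      Real.norm_of_nonneg hr.le, div_mul_cancel₀ _ hgn.ne']))
  have h2 := abs_le.1 (h c (Metric.mem_closedBall_self hr.le))
  rw [le_div_iff₀ hr]
  linarith [h1.2, h2.1]

end Affine

namespace TriMesh

open scoped Classical

variable {𝒯 : TriMesh}

theorem diam_hull_le {s t : Finset Pt} (h : s ⊆ t) : Metric.diam (hull s) ≤ Metric.diam (hull t) :=
  Metric.diam_mono (convexHull_mono (by exact_mod_cast h))
    (t.finite_toSet.isCompact_convexHull ℝ).isBounded

theorem dist_le_diam_hull {s : Finset Pt} {x y : Pt} (hx : x ∈ hull s) (hy : y ∈ hull s) :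
    dist x y ≤ Metric.diam (hull s) :=
  Metric.dist_le_diam_of_mem (s.finite_toSet.isCompact_convexHull ℝ).isBounded hx hy

theorem diam_hull_pos {s : Finset Pt} (hs : 1 < s.card) : 0 < Metric.diam (hull s) := by
  obtain ⟨P, hP, Q, hQ, hPQ⟩ := Finset.one_lt_card.1 hs
  exact (dist_pos.2 hPQ).trans_le
    (dist_le_diam_hull (subset_convexHull _ _ hP) (subset_convexHull _ _ hQ))

theorem diam_cell_pos {T : Finset Pt} (hT : T ∈ 𝒯.cells) : 0 < Metric.diam (hull T) :=
  diam_hull_pos (by rw [𝒯.card_cell T hT]; norm_num)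

theorem IsRegular.norm_gradient_le {σ : ℝ} (hσ : 0 < σ) (h𝒯 : 𝒯.IsRegular σ) {T : Finset Pt}
    (hT : T ∈ 𝒯.cells) (a : Pt →ᵃ[ℝ] ℝ) {m : ℝ} (hm : ∀ P ∈ T, |a P| ≤ m) (x : Pt) :
    ‖gradient a x‖ ≤ 2 * σ * m / Metric.diam (hull T) := by
  obtain ⟨c, hc⟩ := h𝒯 T hT
  have hd := diam_cell_pos hT
  have := _root_.norm_gradient_le a (div_pos hd hσ)
    (fun y hy => abs_le_on_convexHull a (m := m) (by simpa using hm) (hc hy)) x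
  convert this using 1
  field_simp

/-- By conformity the coordinate of a vertex of `T` outside `T'` vanishes on the intersection, yet
it increases along any step towards that vertex. -/
theorem interior_inter_hull_eq_empty {T T' : Finset Pt} (hT : T ∈ 𝒯.cells) (hT' : T' ∈ 𝒯.cells)
    (hne : T ≠ T') : interior (hull T ∩ hull T') = ∅ := by
  by_contra h
  obtain ⟨y, hy⟩ := Set.nonempty_iff_ne_empty.2 h
  obtain ⟨P, hP, hP'⟩ : ∃ P ∈ T, P ∉ T' := by
    by_contra! hs
    exact hne (Finset.eq_of_subset_of_card_le hs
      (by rw [𝒯.card_cell T hT, 𝒯.card_cell T' hT']))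
  have hz : ∀ z ∈ hull T ∩ hull T', bary T P z = 0 := fun z hz => by
    by_contra h0
    exact hP' (mem_of_bary_ne_zero hT hT' hP hz.1 hz.2 h0)
  have hlm : Continuous fun ε : ℝ => AffineMap.lineMap y P ε := AffineMap.lineMap_continuous
  have hev : ∀ᶠ ε in 𝓝[>] (0 : ℝ), AffineMap.lineMap y P ε ∈ hull T ∩ hull T' :=
    ((hlm.tendsto' 0 y (by simp)).eventually (mem_interior_iff_mem_nhds.1 hy)).filter_mono
      nhdsWithin_le_nhds
  obtain ⟨ε, hε, hε0⟩ := (hev.and self_mem_nhdsWithin).exists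
  have := hz _ hε
  rw [affineMap_apply_lineMap, hz y (interior_subset hy), bary_apply (isTriangle hT) hP hP,
    if_pos rfl] at this
  have hε0' : (0 : ℝ) < ε := hε0
  linarith

/-- The number of triangles at a node is bounded in terms of the shape regularity. -/
theorem IsRegular.card_cells_at_le {σ : ℝ} (hσ : 0 < σ) (h𝒯 : 𝒯.IsRegular σ) (N : Pt) :
    (𝒯.cells.filter (N ∈ ·)).card ≤ ⌊σ ^ 2⌋₊ := by
  set S := 𝒯.cells.filter (N ∈ ·) with hS
  rcases S.eq_empty_or_nonempty with h0 | hne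
  · simp [h0]
  have hSc : ∀ T ∈ S, T ∈ 𝒯.cells := fun T hT => (Finset.mem_filter.1 hT).1
  have hSN : ∀ T ∈ S, N ∈ hull T := fun T hT => subset_convexHull _ _ (Finset.mem_filter.1 hT).2
  obtain ⟨T₀, hT₀, hmin⟩ := S.exists_min_image (fun T => Metric.diam (hull T)) hne
  set r := Metric.diam (hull T₀) with hr
  have hr0 : 0 < r := diam_cell_pos (hSc T₀ hT₀)
  have hball : ∀ T ∈ S, ∃ c : Pt, Metric.ball c (r / σ) ⊆ hull T ∩ Metric.closedBall N r := by
    intro T hT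
    obtain ⟨c, hc⟩ := h𝒯 T (hSc T hT)
    set d := Metric.diam (hull T) with hd
    have hd0 : 0 < d := diam_cell_pos (hSc T hT)
    have hrd : r ≤ d := hmin T hT
    -- The triangles at `N` can differ in size. Contracting each towards `N` by the factor `r / d`,
    -- with `r` the smallest diameter, turns its disc into one of radius `r / σ` within distance `r`
    -- of `N`.
    refine ⟨N + (r / d) • (c - N), fun y hy => ?_⟩
    set z : Pt := N + (d / r) • (y - N) with hz
    have hyz : y = N + (r / d) • (z - N) := by
      rw [hz, add_sub_cancel_left, smul_smul, div_mul_div_comm, mul_comm, div_self (by positivity),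
        one_smul, add_sub_cancel]
    have hzT : z ∈ hull T := by
      refine hc ?_
      rw [Metric.mem_ball, dist_eq_norm] at hy
      rw [Metric.mem_closedBall, dist_eq_norm]
      have : y - (N + (r / d) • (c - N)) = (r / d) • (z - c) := by
        conv_lhs => rw [hyz]
        module
      rw [this, norm_smul, Real.norm_of_nonneg (by positivity)] at hy
      rw [div_mul_eq_mul_div, div_lt_div_iff₀ hd0 hσ] at hy
      rw [le_div_iff₀ hσ]
      nlinarith
    refine ⟨?_, ?_⟩
    · have := (convex_convexHull ℝ (T : Set Pt)).lineMap_mem (hSN T hT) hzT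
        (t := r / d) ⟨by positivity, by rw [div_le_one hd0]; exact hrd⟩
      rw [AffineMap.lineMap_apply, vsub_eq_sub, vadd_eq_add, add_comm, ← hyz] at this
      exact this
    · rw [Metric.mem_closedBall, dist_eq_norm, hyz, add_sub_cancel_left, norm_smul,
        Real.norm_of_nonneg (by positivity), ← dist_eq_norm]
      calc r / d * dist z N ≤ r / d * d := by
            gcongr
            exact dist_le_diam_hull hzT (hSN T hT)
        _ = r := by field_simp
  choose! c hc using hball
  have hdisj : (S : Set (Finset Pt)).PairwiseDisjoint fun T => Metric.ball (c T) (r / σ) := by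
    intro T hT T' hT' hne
    rw [Function.onFun, Set.disjoint_iff]
    rintro y ⟨hy, hy'⟩
    have hint := interior_inter_hull_eq_empty (hSc T hT) (hSc T' hT') hne
    have : y ∈ interior (hull T ∩ hull T') := by
      refine mem_interior.2 ⟨Metric.ball (c T) (r / σ) ∩ Metric.ball (c T') (r / σ), ?_,
        Metric.isOpen_ball.inter Metric.isOpen_ball, hy, hy'⟩
      exact fun z hz => ⟨(hc T hT hz.1).1, (hc T' hT' hz.2).1⟩
    rw [hint] at this
    exact this
  -- Comparing areas of the disjoint discs with that of the large one: `n (r / σ)² ≤ r²`.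
  have hvol : volume (⋃ T ∈ S, Metric.ball (c T) (r / σ)) ≤ volume (Metric.closedBall N r) :=
    measure_mono (Set.iUnion₂_subset fun T hT => (hc T hT).trans Set.inter_subset_right)
  rw [measure_biUnion_finset hdisj fun _ _ => measurableSet_ball] at hvol
  have hrσ : 0 < r / σ := div_pos hr0 hσ
  simp only [Measure.addHaar_ball _ _ hrσ.le, Measure.addHaar_closedBall _ _ hr0.le,
    Finset.sum_const, finrank_euclideanSpace, Fintype.card_fin, nsmul_eq_mul, ← mul_assoc] at hvol
  rw [ENNReal.mul_le_mul_iff_left (Metric.measure_ball_pos _ _ one_pos).ne'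
    measure_ball_lt_top.ne, ← ENNReal.ofReal_natCast, ← ENNReal.ofReal_mul (by positivity),
    ENNReal.ofReal_le_ofReal_iff (by positivity)] at hvol
  refine Nat.le_floor ?_
  rw [div_pow, mul_div_assoc', div_le_iff₀ (by positivity)] at hvol
  have : 0 < r ^ 2 := by positivity
  nlinarith

end TriMesh

/-! ### Solving for prescribed jumps at a node -/

namespace TriMesh

open scoped Classical

variable {𝒯 : TriMesh}

/-- A point of an edge is thus a limit of points inside an adjacent triangle, which transfers
information from edges on the boundary of the domain to triangles. -/
theorem hull_subset_closure_interior {T : Finset Pt} (hT : IsTriangle T) :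
    hull T ⊆ closure (interior (hull T)) := by
  have hne : (interior (hull T)).Nonempty := by
    rw [hull, interior_convexHull_nonempty_iff_affineSpan_eq_top]
    have := hT.affineSpan_eq_top
    rwa [Subtype.range_coe] at this
  have hc : Convex ℝ (hull T) := convex_convexHull ℝ _
  rw [hc.closure_interior_eq_closure_of_nonempty_interior hne]
  exact subset_closure

theorem interior_hull_subset_domain {T : Finset Pt} (hT : T ∈ 𝒯.cells) :
    interior (hull T) ⊆ 𝒯.domain :=
  interior_mono (Set.subset_biUnion_of_mem (u := fun T => hull T) hT)

theorem IsRegular.card_edges_at_le {σ : ℝ} (hσ : 0 < σ) (h𝒯 : 𝒯.IsRegular σ) (N : Pt) :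
    (𝒯.edges.filter (N ∈ ·)).card ≤ ⌊σ ^ 2⌋₊ * 3 := by
  have hsub : 𝒯.edges.filter (N ∈ ·) ⊆
      (𝒯.cells.filter (N ∈ ·)).biUnion (Finset.powersetCard 2) := by
    intro F hF
    obtain ⟨hF, hN⟩ := Finset.mem_filter.1 hF
    obtain ⟨hF2, T, hT, hFT⟩ := mem_edges_iff.1 hF
    exact Finset.mem_biUnion.2 ⟨T, Finset.mem_filter.2 ⟨hT, hFT hN⟩,
      Finset.mem_powersetCard.2 ⟨hFT, hF2⟩⟩
  refine (Finset.card_le_card hsub).trans ((Finset.card_biUnion_le_card_mul _ _ 3 ?_).trans ?_)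
  · intro T hT
    rw [Finset.card_powersetCard, 𝒯.card_cell T (Finset.mem_filter.1 hT).1]
    decide
  · exact Nat.mul_le_mul_right _ (h𝒯.card_cells_at_le hσ N)

end TriMesh

/-! ### Orientation signs and solvability of the jump equations at a node -/

namespace CutMesh

open scoped Classical

variable {S : CutMesh} {c : EdgeConvention} {i : Fin 2}

theorem sub_subset_domain (i : Fin 2) : S.sub i ⊆ S.domain := by
  have h : S.sub 0 ∪ S.sub 1 ⊆ S.domain := S.union_sub.trans_subset Set.sdiff_subset
  fin_cases i
  · exact Set.subset_union_left.trans h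
  · exact Set.subset_union_right.trans h

theorem mem_cellsOf {T : Finset Pt} :
    T ∈ S.cellsOf i ↔ T ∈ S.cells ∧ (hull T ∩ S.sub i).Nonempty := Finset.mem_filter

theorem mem_edgesOf {F : Finset Pt} :
    F ∈ S.edgesOf c i ↔ F ∈ S.edges ∧ (hull F ∩ S.target c i).Nonempty := Finset.mem_filter

theorem exists_other (i : Fin 2) : ∃ j, Disjoint (S.sub i) (S.sub j) ∧
    S.Γ = frontier (S.sub i) ∩ frontier (S.sub j) ∧ S.sub i ∪ S.sub j = S.domain \ S.Γ := by
  fin_cases i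
  · exact ⟨1, S.disjoint_sub, rfl, S.union_sub⟩
  · exact ⟨0, S.disjoint_sub.symm, Set.inter_comm _ _, (Set.union_comm _ _).trans S.union_sub⟩

/-- The triangles adjacent to an edge of `𝓕_hⁱ` belong to `𝓣_hⁱ`. -/
theorem mem_cellsOf_of_edge {F T : Finset Pt} (hF : F ∈ S.edgesOf c i) (hT : T ∈ S.cells)
    (hFT : F ⊆ T) : T ∈ S.cellsOf i := by
  refine mem_cellsOf.2 ⟨hT, ?_⟩
  obtain ⟨-, x, hxF, hx⟩ := mem_edgesOf.1 hF
  have hxT : x ∈ hull T := convexHull_mono (by exact_mod_cast hFT) hxF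
  cases c with
  | interior => exact ⟨x, hxT, hx⟩
  | withBoundary =>
    obtain ⟨hxc, hxΓ⟩ : x ∈ closure (S.sub i) ∧ x ∉ S.Γ := hx
    by_cases hxi : x ∈ S.sub i
    · exact ⟨x, hxT, hxi⟩
    obtain ⟨j, hd, hΓ, hU⟩ := S.exists_other i
    have hxfi : x ∈ frontier (S.sub i) := by
      rw [(S.isOpen_sub i).frontier_eq]; exact ⟨hxc, hxi⟩
    have hxj : x ∉ closure (S.sub j) := by
      intro h
      by_cases hxj : x ∈ S.sub j
      · obtain ⟨y, hy, hy'⟩ := mem_closure_iff.1 hxc _ (S.isOpen_sub j) hxj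
        exact Set.disjoint_left.1 hd hy' hy
      · refine hxΓ (hΓ ▸ ⟨hxfi, ?_⟩)
        rw [(S.isOpen_sub j).frontier_eq]; exact ⟨h, hxj⟩
    -- Since `x` has positive distance from the other subdomain, a nearby point inside `T` avoids
    -- the closure of that subdomain, hence also `Γ`, and can only lie in `S.sub i`.
    obtain ⟨y, hyj, hyT⟩ := mem_closure_iff.1
      (TriMesh.hull_subset_closure_interior (TriMesh.isTriangle hT) hxT) _
      isClosed_closure.isOpen_compl hxj
    have hyΓ : y ∉ S.Γ := fun h => by
      rw [hΓ] at h
      exact hyj (frontier_subset_closure h.2)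
    have hy : y ∈ S.sub i ∪ S.sub j := by
      rw [hU]; exact ⟨TriMesh.interior_hull_subset_domain hT hyT, hyΓ⟩
    exact ⟨y, interior_subset hyT, hy.resolve_right fun h => hyj (subset_closure h)⟩

theorem not_isBoundaryEdge {F : Finset Pt} (hF : F ∈ S.edgesOf .interior i) :
    ¬ S.IsBoundaryEdge F :=
  TriMesh.not_isBoundaryEdge_of_inter_nonempty (S.isOpen_sub i) (sub_subset_domain i)
    (mem_edgesOf.1 hF).2

theorem nodeSign_mul_self (F : Finset Pt) (N : Pt) : S.nodeSign F N * S.nodeSign F N = 1 := by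
  unfold nodeSign; split_ifs <;> norm_num

theorem abs_outSign (T F : Finset Pt) : |S.outSign T F| = 1 := by
  unfold outSign; split_ifs <;> norm_num

theorem inner_pt (x y : Pt) : inner ℝ x y = x 0 * y 0 + x 1 * y 1 := by
  simp [PiLp.inner_apply, Fin.sum_univ_two, mul_comm]

theorem det_ne_zero {T : Finset Pt} (hT : IsTriangle T) {N P Q : Pt} (hNP : N ≠ P)
    (hNQ : N ≠ Q) (hPQ : P ≠ Q) (hTe : T = {N, P, Q}) :
    (P - N) 0 * (Q - N) 1 - (P - N) 1 * (Q - N) 0 ≠ 0 := by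
  intro h
  have hN : N ∈ T := by simp [hTe]
  have hP : P ∈ T := by simp [hTe]
  have hQ : Q ∈ T := by simp [hTe]
  have hlin : ∀ x, (bary T Q).linear (x - N) = bary T Q x - bary T Q N := fun x =>
    (bary T Q).linearMap_vsub x N
  have l1 : (bary T Q).linear (P - N) = 0 := by
    rw [hlin, bary_apply hT hQ hP, bary_apply hT hQ hN]; simp [hPQ.symm, hNQ.symm]
  have l2 : (bary T Q).linear (Q - N) = 1 := by
    rw [hlin, bary_apply hT hQ hQ, bary_apply hT hQ hN]; simp [hNQ.symm]
  have key : ∀ j : Fin 2, (P - N) j • (Q - N) = (Q - N) j • (P - N) := by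
    intro j
    ext k
    simp only [PiLp.smul_apply, smul_eq_mul]
    fin_cases j <;> fin_cases k <;> simp only [Fin.mk_zero, Fin.mk_one] <;> linarith
  have hz : ∀ j : Fin 2, (P - N) j = 0 := fun j => by
    have := congrArg (bary T Q).linear (key j)
    rw [map_smul, map_smul, l1, l2] at this
    simpa using this
  refine hNP (sub_eq_zero.1 ?_).symm
  ext j
  exact hz j

/-- Reversing the normal flips both signs, so the product depends only on the orientation of the
triple `(N, P, Q)`. Swapping `P` and `Q` then reverses it. -/
theorem outSign_mul_nodeSign {T : Finset Pt} (hT : T ∈ S.cells) {N P Q : Pt} (hNP : N ≠ P)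
    (hNQ : N ≠ Q) (hPQ : P ≠ Q) (hTe : T = {N, P, Q}) :
    S.outSign T {N, P} * S.nodeSign {N, P} N
      = if 0 < (P - N) 0 * (Q - N) 1 - (P - N) 1 * (Q - N) 0 then 1 else -1 := by
  have hF : ({N, P} : Finset Pt) ∈ S.edges := TriMesh.mem_edges_iff.2
    ⟨Finset.card_pair hNP, T, hT, by simp [hTe, Finset.insert_subset_iff]⟩
  set n := S.normal {N, P} with hn
  have hnorm : n 0 * n 0 + n 1 * n 1 = 1 := by
    rw [← inner_pt, real_inner_self_eq_norm_sq, S.norm_normal _ hF, one_pow]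
  have hperp : n 0 * (P - N) 0 + n 1 * (P - N) 1 = 0 := by
    rw [← inner_pt]; exact S.normal_perp _ hF P (by simp) N (by simp)
  have hQP : inner ℝ n (Q - P) = inner ℝ n (Q - N) := by
    have h0 : inner ℝ n (P - N) = 0 := S.normal_perp _ hF P (by simp) N (by simp)
    have : Q - N = (Q - P) + (P - N) := by abel
    rw [this, inner_add_right, h0, add_zero]
  have hout : S.outSign T {N, P} = if inner ℝ n (Q - N) < 0 then 1 else -1 := by
    unfold outSign
    congr 1
    refine propext ⟨fun h => h Q (by simp [hTe]) (by simp [hNQ.symm, hPQ.symm]) N (by simp), ?_⟩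
    intro h V hV hVF M hM
    have hV' : V = Q := by
      simp only [hTe, Finset.mem_insert, Finset.mem_singleton] at hV hVF
      tauto
    subst hV'
    have hM' : M = N ∨ M = P := by simpa using hM
    rcases hM' with rfl | rfl
    · exact h
    · rw [← hn, hQP]; exact h
  have hnode : S.nodeSign {N, P} N = if 0 < inner ℝ n (cw (P - N)) then 1 else -1 := by
    unfold nodeSign
    congr 1
    refine propext ⟨fun h => h P (by simp) hNP.symm, fun h M hM hMN => ?_⟩
    have hM' : M = N ∨ M = P := by simpa using hM
    rcases hM' with rfl | rfl
    · exact absurd rfl hMN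
    · exact h
  have hdet := det_ne_zero (TriMesh.isTriangle hT) hNP hNQ hPQ hTe
  have hcw : inner ℝ n (cw (P - N)) = n 0 * (P - N) 1 - n 1 * (P - N) 0 := by
    rw [inner_pt]; simp only [cw]; simp; ring
  rw [hout, hnode, hcw, inner_pt]
  have hpne : (P - N) 0 * (P - N) 0 + (P - N) 1 * (P - N) 1 ≠ 0 := by
    rw [← inner_pt, real_inner_self_eq_norm_sq]
    exact pow_ne_zero 2 (norm_ne_zero_iff.2 (sub_ne_zero.2 hNP.symm))
  generalize (P - N) 0 = p0 at *
  generalize (P - N) 1 = p1 at *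
  generalize (Q - N) 0 = q0 at *
  generalize (Q - N) 1 = q1 at *
  generalize n 0 = n0 at *
  generalize n 1 = n1 at *
  set s := n0 * p1 - n1 * p0 with hs
  set D := p0 * q1 - p1 * q0 with hD
  -- As `n` is a unit vector orthogonal to `P - N`, Lagrange's identity gives `s ≠ 0`, and `e2` ties
  -- the sign of `⟨n, Q - N⟩` to those of `s` and `D`.
  have e1 : s ^ 2 = p0 * p0 + p1 * p1 := by
    have : s ^ 2 + (n0 * p0 + n1 * p1) ^ 2 = (n0 * n0 + n1 * n1) * (p0 * p0 + p1 * p1) := by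
      rw [hs]; ring
    rw [hperp, hnorm] at this; linarith
  have hs0 : s ≠ 0 := by
    intro h; rw [h] at e1; exact hpne (by linarith)
  have e2 : s * (n0 * q0 + n1 * q1) = -D := by
    have : s * (n0 * q0 + n1 * q1) = -D * (n0 * n0 + n1 * n1)
        + (n0 * p0 + n1 * p1) * (n0 * q1 - n1 * q0) := by rw [hs, hD]; ring
    rw [hperp, hnorm] at this; linarith
  rcases lt_or_gt_of_ne hs0 with h1 | h1 <;> rcases lt_or_gt_of_ne hdet with h2 | h2
  · rw [if_pos (by nlinarith), if_neg h1.not_gt, if_neg h2.not_gt]; norm_num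
  · rw [if_neg (by nlinarith), if_neg h1.not_gt, if_pos h2]; norm_num
  · rw [if_neg (by nlinarith), if_pos h1, if_neg h2.not_gt]; norm_num
  · rw [if_pos (by nlinarith), if_pos h1, if_pos h2]; norm_num

/-- Seen from a triangle, its two edges at a node are oriented in opposite senses. -/
theorem outSign_mul_nodeSign_add {T : Finset Pt} (hT : T ∈ S.cells) {N P Q : Pt} (hNP : N ≠ P)
    (hNQ : N ≠ Q) (hPQ : P ≠ Q) (hTe : T = {N, P, Q}) :
    S.outSign T {N, P} * S.nodeSign {N, P} N + S.outSign T {N, Q} * S.nodeSign {N, Q} N = 0 := by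
  have hdet := det_ne_zero (TriMesh.isTriangle hT) hNP hNQ hPQ hTe
  rw [outSign_mul_nodeSign hT hNP hNQ hPQ hTe,
    outSign_mul_nodeSign hT hNQ hNP hPQ.symm (by rw [hTe]; ext; simp; tauto)]
  rcases lt_or_gt_of_ne hdet with h | h
  · rw [if_neg h.not_gt, if_pos (by linarith)]; norm_num
  · rw [if_pos h, if_neg (by linarith)]; norm_num

/-- A non-empty saturated set of edges of `𝓕_hⁱ` at `N` consists of all edges at `N`, and `N` is
a constrained node. -/
theorem isConstrainedNode_of_isSaturated (hc : c = .withBoundary → S.HasSimpleBoundary) {N : Pt}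
    {A : Set (Finset Pt)} (hA : S.IsSaturated N A) (hne : A.Nonempty)
    (hAE : ∀ F ∈ A, F ∈ S.edgesOf c i) :
    (∀ F ∈ S.edges, N ∈ F → F ∈ A) ∧ S.IsConstrainedNode c i N := by
  have hnode : N ∈ S.nodes := by
    obtain ⟨F, hF⟩ := hne
    obtain ⟨-, T, hT, hFT⟩ := TriMesh.mem_edges_iff.1 (hA.mem F hF).1
    exact Finset.mem_biUnion.2 ⟨T, hT, hFT (hA.mem F hF).2⟩
  cases c with
  | interior =>
    have hb : ∀ F ∈ A, ¬ S.IsBoundaryEdge F := fun F hF => not_isBoundaryEdge (hAE F hF)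
    refine ⟨fun F hF hN => hA.mem_of_interior hne hb hF hN, hnode, ?_⟩
    change S.patch i ∈ 𝓝 N
    filter_upwards [hA.eventually_exists_mem_hull hne hb] with y hy
    obtain ⟨T, hT, hyT⟩ := hy
    obtain ⟨hTc, F, hF, hFT⟩ := TriMesh.mem_cellsAlong.1 hT
    exact Set.mem_biUnion (mem_cellsOf_of_edge (hAE F hF) hTc hFT) hyT
  | withBoundary =>
    have hall : ∀ F ∈ S.edges, N ∈ F → F ∈ A := fun F hF hN =>
      hA.mem_of_simpleBoundary (hc rfl) hne hF hN
    refine ⟨hall, hnode, ?_⟩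
    change S.patch i ∈ 𝓝[closure S.domain] N
    rw [mem_nhdsWithin_iff_eventually]
    filter_upwards [S.eventually_mem_hull N] with y hy hyD
    have hyU : y ∈ ⋃ T ∈ S.cells, hull T :=
      closure_minimal interior_subset (isClosed_biUnion_finset fun T _ => isClosed_hull T) hyD
    simp only [Set.mem_iUnion] at hyU
    obtain ⟨T, hT, hyT⟩ := hyU
    obtain ⟨T', hT', hN'⟩ := Finset.mem_biUnion.1 hnode
    -- Close to `N`, a triangle containing `y` contains the point `N`, hence by conformity has it as
    -- a vertex. Its edges at `N` belong to 𝓕_hⁱ, so the triangle belongs to 𝓣_hⁱ.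
    have hN : N ∈ T := TriMesh.mem_of_bary_ne_zero hT' hT hN' (subset_convexHull _ _ hN')
      (hy T hT hyT) (by rw [bary_apply (TriMesh.isTriangle hT') hN' hN']; simp)
    obtain ⟨P, Q, hNP, -, -, hTe⟩ := (TriMesh.isTriangle hT).exists_vertices hN
    have hFT : {N, P} ⊆ T := by simp [hTe, Finset.insert_subset_iff]
    have hF := hall {N, P} (TriMesh.mem_edges_iff.2 ⟨Finset.card_pair hNP, T, hT, hFT⟩) (by simp)
    exact Set.mem_biUnion (mem_cellsOf_of_edge (hAE _ hF) hT hFT) hyT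

/-- Data that satisfy the constraint at `N` are orthogonal to the cokernel of the jumps at `N`. -/
theorem sum_mul_eq_zero (hc : c = .withBoundary → S.HasSimpleBoundary) {N : Pt}
    {g l : Finset Pt → ℝ}
    (hg : S.IsConstrainedNode c i N →
      ∑ F ∈ (S.edgesOf c i).filter (N ∈ ·), S.nodeSign F N * g F = 0)
    (hl : ∀ T ∈ S.cellsOf i, N ∈ T → ∑ F ∈ (S.edgesOf c i).filter (N ∈ ·),
      l F * (if F ⊆ T then S.outSign T F else 0) = 0) :
    ∑ F ∈ (S.edgesOf c i).filter (N ∈ ·), l F * g F = 0 := by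
  by_cases h0 : ∀ F ∈ (S.edgesOf c i).filter (N ∈ ·), l F = 0
  · exact Finset.sum_eq_zero fun F hF => by rw [h0 F hF, zero_mul]
  push Not at h0
  obtain ⟨F₀, hF₀, hl₀⟩ := h0
  obtain ⟨hF₀E, hF₀N⟩ := Finset.mem_filter.1 hF₀
  -- The sign-corrected cokernel vector. The value zero off 𝓕_hⁱ matters: a triangle with only one
  -- edge of 𝓕_hⁱ at `N` then forces the value zero on that edge too.
  set lam : Finset Pt → ℝ := fun F => if F ∈ S.edgesOf c i then S.nodeSign F N * l F else 0
    with hlam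
  have hns : ∀ F, S.nodeSign F N ≠ 0 := fun F h => by
    have := S.nodeSign_mul_self F N
    rw [h] at this; norm_num at this
  have hc0 : lam F₀ ≠ 0 := by
    simp only [hlam, if_pos hF₀E]; exact mul_ne_zero (hns F₀) hl₀
  have heq : ∀ T ∈ S.cellsOf i, ∀ P Q, N ≠ P → N ≠ Q → P ≠ Q → T = {N, P, Q} →
      lam {N, P} = lam {N, Q} := by
    intro T hT P Q hNP hNQ hPQ hTe
    have hTc := (mem_cellsOf.1 hT).1
    have h1 := hl T hT (by simp [hTe])
    simp only [mul_ite, mul_zero] at h1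
    rw [← Finset.sum_filter] at h1
    have hset : ((S.edgesOf c i).filter (N ∈ ·)).filter (· ⊆ T)
        = ({{N, P}, {N, Q}} : Finset (Finset Pt)).filter (· ∈ S.edgesOf c i) := by
      ext F
      simp only [Finset.mem_filter, Finset.mem_insert, Finset.mem_singleton]
      constructor
      · rintro ⟨⟨hF, hN⟩, hFT⟩
        refine ⟨?_, hF⟩
        obtain ⟨P', Q', g1, -, -, g4, rfl⟩ := (TriMesh.isTriangle hTc).exists_third hFT
          (TriMesh.mem_edges_iff.1 (mem_edgesOf.1 hF).1).1 hN
        have : P' ∈ T := by simp [g4]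
        have : P' = N ∨ P' = P ∨ P' = Q := by simpa [hTe] using this
        rcases this with rfl | rfl | rfl
        · exact absurd rfl g1
        · exact Or.inl rfl
        · exact Or.inr rfl
      · rintro ⟨rfl | rfl, hF⟩
        · exact ⟨⟨hF, by simp⟩, by simp [hTe, Finset.insert_subset_iff]⟩
        · exact ⟨⟨hF, by simp⟩, by simp [hTe, Finset.insert_subset_iff]⟩
    have hPQ' : ({N, P} : Finset Pt) ≠ {N, Q} := fun h => by
      have : P ∈ ({N, Q} : Finset Pt) := h ▸ by simp
      simp [hNP.symm, hPQ] at this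
    rw [hset, Finset.sum_filter, Finset.sum_pair hPQ'] at h1
    have hterm : ∀ F, (if F ∈ S.edgesOf c i then l F * S.outSign T F else 0)
        = S.outSign T F * S.nodeSign F N * lam F := fun F => by
      simp only [hlam]
      split_ifs
      · linear_combination (-(l F * S.outSign T F)) * S.nodeSign_mul_self F N
      · simp
    rw [hterm, hterm] at h1
    have h2 := outSign_mul_nodeSign_add hTc hNP hNQ hPQ hTe
    have h3 : S.outSign T {N, P} * S.nodeSign {N, P} N ≠ 0 := by
      refine mul_ne_zero (fun h => ?_) (hns _)
      have := S.abs_outSign T {N, P}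
      rw [h] at this; norm_num at this
    have h4 : S.outSign T {N, P} * S.nodeSign {N, P} N * (lam {N, P} - lam {N, Q}) = 0 := by
      linear_combination h1 - lam {N, Q} * h2
    exact sub_eq_zero.1 ((mul_eq_zero.1 h4).resolve_left h3)
  -- The level set of a non-zero value is saturated, because the value passes from each edge to the
  -- other edge at `N` of an adjacent triangle. It stays within 𝓕_hⁱ since `lam` vanishes elsewhere.
  set A : Set (Finset Pt) := {F | F ∈ S.edges ∧ N ∈ F ∧ lam F = lam F₀} with hAdef
  have hAE : ∀ F ∈ A, F ∈ S.edgesOf c i := fun F hF => by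
    by_contra h
    have := hF.2.2
    rw [hlam] at this
    simp only [if_neg h] at this
    exact hc0 this.symm
  have hA : S.IsSaturated N A := by
    refine ⟨fun F hF => ⟨hF.1, hF.2.1⟩, fun F hF T hT hFT F' hF'T hF'2 hN' => ?_⟩
    refine ⟨TriMesh.mem_edges_iff.2 ⟨hF'2, T, hT, hF'T⟩, hN', ?_⟩
    rw [← hF.2.2]
    obtain ⟨P, Q, hNP, hNQ, hPQ, hTe, hFe⟩ := (TriMesh.isTriangle hT).exists_third hFT
      (TriMesh.mem_edges_iff.1 hF.1).1 hF.2.1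
    obtain ⟨P', Q', h1, -, -, hTe', hFe'⟩ := (TriMesh.isTriangle hT).exists_third hF'T hF'2 hN'
    have : P' ∈ T := by simp [hTe']
    have : P' = N ∨ P' = P ∨ P' = Q := by simpa [hTe] using this
    rw [hFe, hFe']
    rcases this with h | h | h
    · exact absurd h.symm h1
    · rw [h]
    · rw [h]
      exact (heq T (mem_cellsOf_of_edge (hAE F hF) hT hFT) P Q hNP hNQ hPQ hTe).symm
  obtain ⟨hall, hcon⟩ := isConstrainedNode_of_isSaturated hc hA
    ⟨F₀, (mem_edgesOf.1 hF₀E).1, hF₀N, rfl⟩ hAE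
  have hlF : ∀ F ∈ (S.edgesOf c i).filter (N ∈ ·), l F * g F
      = lam F₀ * (S.nodeSign F N * g F) := fun F hF => by
    obtain ⟨hFE, hFN⟩ := Finset.mem_filter.1 hF
    rw [← (hall F (mem_edgesOf.1 hFE).1 hFN).2.2]
    simp only [hlam, if_pos hFE]
    linear_combination (-(l F * g F)) * S.nodeSign_mul_self F N
  rw [Finset.sum_congr rfl hlF, ← Finset.mul_sum, hg hcon, mul_zero]

/-- At each node there are nodal values with prescribed jumps, if the jumps satisfy the constraint
at this node; they are bounded by the jumps, uniformly with respect to the mesh. -/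
theorem exists_nodal_values {σ : ℝ} (hσ : 0 < σ) : ∃ C : ℝ, 0 ≤ C ∧
    ∀ S : CutMesh, S.IsRegular σ → ∀ c : EdgeConvention,
    (c = .withBoundary → S.HasSimpleBoundary) → ∀ (i : Fin 2) (N : Pt) (g : Finset Pt → ℝ),
    (S.IsConstrainedNode c i N →
      ∑ F ∈ (S.edgesOf c i).filter (N ∈ ·), S.nodeSign F N * g F = 0) →
    ∃ f : Finset Pt → ℝ,
      (∀ F ∈ S.edgesOf c i, N ∈ F →
        ∑ T ∈ S.cellsOf i, (if F ⊆ T then S.outSign T F * f T else 0) = g F) ∧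
      ∀ T, f T ^ 2 ≤ C * ∑ F ∈ (S.edgesOf c i).filter (N ∈ ·), g F ^ 2 := by
  obtain ⟨C, hC0, hC⟩ := exists_uniformly_bounded_solution (⌊σ ^ 2⌋₊ * 3)
  refine ⟨C, hC0, fun S hS c hc i N g hg => ?_⟩
  set ι := {T // T ∈ (S.cellsOf i).filter (N ∈ ·)}
  set κ := {F // F ∈ (S.edgesOf c i).filter (N ∈ ·)}
  have hι : Fintype.card ι ≤ ⌊σ ^ 2⌋₊ * 3 := by
    rw [Fintype.card_coe]
    refine (Finset.card_le_card ?_).trans ((hS.card_cells_at_le hσ N).trans (by omega))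
    exact Finset.filter_subset_filter _ (Finset.filter_subset _ _)
  have hκ : Fintype.card κ ≤ ⌊σ ^ 2⌋₊ * 3 := by
    rw [Fintype.card_coe]
    refine (Finset.card_le_card ?_).trans (hS.card_edges_at_le hσ N)
    exact Finset.filter_subset_filter _ (Finset.filter_subset _ _)
  obtain ⟨f, hf, hfb⟩ := hC ι κ hι hκ
    (fun F T => if F.1 ⊆ T.1 then S.outSign T.1 F.1 else 0) (by
      intro F T
      unfold outSign
      split_ifs
      · exact ⟨1, by simp⟩
      · exact ⟨-1, by simp⟩
      · exact ⟨0, by simp⟩) (fun F => g F.1) (by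
      intro l hl
      set l' : Finset Pt → ℝ := fun F =>
        if h : F ∈ (S.edgesOf c i).filter (N ∈ ·) then l ⟨F, h⟩ else 0 with hl'
      have hll : ∀ F : κ, l F = l' F.1 := fun F => by
        simp only [hl', dif_pos F.2]
        rfl
      have := sum_mul_eq_zero (l := l') hc hg (fun T hT hN => by
        have := hl ⟨T, Finset.mem_filter.2 ⟨hT, hN⟩⟩
        simp only [hll] at this
        rw [← Finset.sum_coe_sort]
        exact this)
      rw [← Finset.sum_coe_sort] at this
      simp only [hll]
      exact this)
  refine ⟨fun T => if h : T ∈ (S.cellsOf i).filter (N ∈ ·) then f ⟨T, h⟩ else 0, ?_, ?_⟩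
  · intro F hF hN
    rw [← hf ⟨F, Finset.mem_filter.2 ⟨hF, hN⟩⟩]
    rw [← Finset.sum_subset (Finset.filter_subset (N ∈ ·) (S.cellsOf i)), ← Finset.sum_coe_sort]
    · refine Finset.sum_congr rfl fun T _ => ?_
      simp only [dif_pos T.2, ite_mul, zero_mul]
    · intro T hT hT'
      simp only [dif_neg hT', mul_zero, ite_self]
  · intro T
    have hsum : ∑ F : κ, g F.1 ^ 2 = ∑ F ∈ (S.edgesOf c i).filter (N ∈ ·), g F ^ 2 :=
      Finset.sum_coe_sort _ fun F => g F ^ 2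
    rw [← hsum]
    by_cases h : T ∈ (S.cellsOf i).filter (N ∈ ·)
    · simp only [dif_pos h]; exact hfb ⟨T, h⟩
    · simp only [dif_neg h, zero_pow two_ne_zero]
      exact mul_nonneg hC0 (Finset.sum_nonneg fun _ _ => sq_nonneg _)

end CutMesh

/-! ### Bounds for the norms by nodal values -/

section Integrals

open scoped Classical

theorem hausdorffMeasure_hull_edge {F : Finset Pt} (hF : F.card = 2) :
    μH[1] (hull F) = ENNReal.ofReal (CutMesh.len F) := by
  obtain ⟨N, P, -, rfl⟩ := Finset.card_eq_two.1 hF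
  rw [CutMesh.len, hull, convexHull_diam, Finset.coe_pair, convexHull_pair,
    hausdorffMeasure_segment, Metric.diam_pair, edist_dist]

/-- Integrability is not required: the Bochner integral of a non-integrable function is zero, so the
bound still holds. -/
theorem setIntegral_le_mul {X : Type*} [MeasurableSpace X] {μ : Measure X} {s : Set X}
    {f : X → ℝ} {B L : ℝ} (hs : μ s ≤ ENNReal.ofReal L) (hL : 0 ≤ L) (hB : 0 ≤ B)
    (h0 : ∀ x ∈ s, 0 ≤ f x) (hf : ∀ x ∈ s, f x ≤ B) : ∫ x in s, f x ∂μ ≤ B * L := by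
  have h1 := norm_setIntegral_le_of_norm_le_const (μ := μ) (s := s) (f := f) (C := B)
    (hs.trans_lt ENNReal.ofReal_lt_top)
    (fun x hx => by rw [Real.norm_of_nonneg (h0 x hx)]; exact hf x hx)
  refine (le_abs_self _).trans (h1.trans ?_)
  gcongr
  exact ENNReal.toReal_le_of_le_ofReal hL hs

/-- By continuity `a` has no zero on a short piece of the edge starting at `N`, and this piece has
positive length. -/
theorem setIntegral_sq_pos {F : Finset Pt} (hF : F.card = 2) (a : Pt →ᵃ[ℝ] ℝ) {N : Pt} (hN : N ∈ F)
    (ha : a N ≠ 0) : 0 < ∫ x in hull F, a x ^ 2 ∂μH[1] := by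
  have hfin : μH[1] (hull F) ≠ ⊤ := by
    rw [hausdorffMeasure_hull_edge hF]; exact ENNReal.ofReal_ne_top
  set m := ∑ P ∈ F, |a P| with hm
  have hb : ∀ x ∈ hull F, |a x| ≤ m := fun x hx => by
    refine abs_le_on_convexHull a (fun P hP => ?_) hx
    exact Finset.single_le_sum (f := fun P => |a P|) (fun _ _ => abs_nonneg _) hP
  have hint : IntegrableOn (fun x => a x ^ 2) (hull F) μH[1] := by
    refine Measure.integrableOn_of_bounded hfin
      (a.continuous_real.pow 2).aestronglyMeasurable (M := m ^ 2) ?_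
    refine (ae_restrict_iff' (isClosed_hull F).measurableSet).2 (Filter.Eventually.of_forall ?_)
    intro x hx
    rw [Real.norm_of_nonneg (sq_nonneg _), ← sq_abs]
    have := hb x hx
    gcongr
  rw [setIntegral_pos_iff_support_of_nonneg_ae
    (Filter.Eventually.of_forall fun _ => sq_nonneg _) hint]
  have hev : ∀ᶠ x in 𝓝 N, a x ≠ 0 := a.continuous_real.continuousAt.eventually_ne ha
  obtain ⟨P, hP⟩ := Finset.card_eq_one.1
    (show (F.erase N).card = 1 by rw [Finset.card_erase_of_mem hN, hF])
  have hPF : P ∈ F.erase N := by simp [hP]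
  have hPN := Finset.ne_of_mem_erase hPF
  obtain ⟨r, hr, hball⟩ := Metric.eventually_nhds_iff_ball.1 hev
  have hlm : Continuous fun ε : ℝ => AffineMap.lineMap N P ε := AffineMap.lineMap_continuous
  have hev' : ∀ᶠ ε in 𝓝[>] (0 : ℝ), AffineMap.lineMap N P ε ∈ Metric.ball N r :=
    ((hlm.tendsto' 0 N (by simp)).eventually (Metric.ball_mem_nhds N hr)).filter_mono
      nhdsWithin_le_nhds
  have h01 : ∀ᶠ ε in 𝓝[>] (0 : ℝ), ε ∈ Set.Ioo (0 : ℝ) 1 := Ioo_mem_nhdsGT one_pos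
  obtain ⟨ε, hε, hε0, hε1⟩ := (hev'.and h01).exists
  set y : Pt := AffineMap.lineMap N P ε with hy
  have hNF : N ∈ hull F := subset_convexHull _ _ hN
  have hyF : y ∈ hull F := (convex_convexHull ℝ _).lineMap_mem hNF
    (subset_convexHull _ _ (Finset.mem_of_mem_erase hPF)) ⟨hε0.le, hε1.le⟩
  have hsub : segment ℝ N y ⊆ Function.support (fun x => a x ^ 2) ∩ hull F := fun z hz => by
    refine ⟨?_, (convex_convexHull ℝ _).segment_subset hNF hyF hz⟩
    have hz' := (convex_ball N r).segment_subset (Metric.mem_ball_self hr) hε hz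
    simpa using hball z hz'
  refine lt_of_lt_of_le ?_ (measure_mono hsub)
  rw [hausdorffMeasure_segment, edist_pos, hy]
  intro h
  have h2 : dist N (AffineMap.lineMap N P ε) = 0 := dist_eq_zero.2 h
  rw [dist_left_lineMap, mul_eq_zero, norm_eq_zero, dist_eq_zero] at h2
  rcases h2 with h2 | h2
  · exact hε0.ne' h2
  · exact hPN h2.symm

end Integrals

namespace TriMesh

open scoped Classical

variable {𝒯 : TriMesh}

theorem IsRegular.card_neighbours_le {σ : ℝ} (hσ : 0 < σ) (h𝒯 : 𝒯.IsRegular σ) {T : Finset Pt}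
    (hT : T ∈ 𝒯.cells) :
    (𝒯.cells.filter fun T' => (T ∩ T').Nonempty).card ≤ 3 * ⌊σ ^ 2⌋₊ := by
  have hsub : (𝒯.cells.filter fun T' => (T ∩ T').Nonempty) ⊆
      T.biUnion fun N => 𝒯.cells.filter (N ∈ ·) := by
    intro T' hT'
    obtain ⟨hT'c, N, hN⟩ := Finset.mem_filter.1 hT'
    rw [Finset.mem_inter] at hN
    exact Finset.mem_biUnion.2 ⟨N, hN.1, Finset.mem_filter.2 ⟨hT'c, hN.2⟩⟩
  refine (Finset.card_le_card hsub).trans ?_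
  rw [← 𝒯.card_cell T hT]
  exact Finset.card_biUnion_le_card_mul _ _ _ fun N _ => h𝒯.card_cells_at_le hσ N

theorem card_edges_of_cell_le {T : Finset Pt} (hT : T ∈ 𝒯.cells) :
    (𝒯.edges.filter (· ⊆ T)).card ≤ 3 := by
  have hsub : 𝒯.edges.filter (· ⊆ T) ⊆ Finset.powersetCard 2 T := by
    intro F hF
    obtain ⟨hFe, hFT⟩ := Finset.mem_filter.1 hF
    exact Finset.mem_powersetCard.2 ⟨hFT, (mem_edges_iff.1 hFe).1⟩
  refine (Finset.card_le_card hsub).trans ?_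
  rw [Finset.card_powersetCard, 𝒯.card_cell T hT]
  decide

end TriMesh

namespace CutMesh

open scoped Classical

variable {S : CutMesh} {c : EdgeConvention} {i : Fin 2}

/-- The sum of the squares of the values of `v` at the vertices of `T`. -/
noncomputable def nodalSq (v : S.BrokenP1 i) (T : S.cellsOf i) : ℝ := ∑ N ∈ T.1, v T N ^ 2

theorem nodalSq_nonneg (v : S.BrokenP1 i) (T : S.cellsOf i) : 0 ≤ nodalSq v T :=
  Finset.sum_nonneg fun _ _ => sq_nonneg _

theorem cell_mem (T : S.cellsOf i) : T.1 ∈ S.cells := (mem_cellsOf.1 T.2).1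

theorem edge_card {F : Finset Pt} (hF : F ∈ S.edges) : F.card = 2 := (TriMesh.mem_edges_iff.1 hF).1

theorem len_pos {F : Finset Pt} (hF : F ∈ S.edges) : 0 < len F :=
  TriMesh.diam_hull_pos (by rw [edge_card hF]; norm_num)

theorem abs_vertex_le (v : S.BrokenP1 i) (T : S.cellsOf i) {N : Pt} (hN : N ∈ T.1) :
    |v T N| ≤ √(nodalSq v T) :=
  Real.abs_le_sqrt (Finset.single_le_sum (f := fun N => v T N ^ 2) (fun _ _ => sq_nonneg _) hN)

theorem abs_apply_le (v : S.BrokenP1 i) (T : S.cellsOf i) {x : Pt} (hx : x ∈ hull T.1) :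
    |v T x| ≤ √(nodalSq v T) :=
  abs_le_on_convexHull _ (fun _ hN => abs_vertex_le v T hN) hx

theorem card_filter_cellsOf_le (p : Finset Pt → Prop) [DecidablePred p] :
    (Finset.univ.filter fun T : S.cellsOf i => p T.1).card ≤ (S.cells.filter p).card := by
  refine Finset.card_le_card_of_injOn Subtype.val (fun T hT => ?_) Subtype.val_injective.injOn
  have := (Finset.mem_filter.1 (Finset.mem_coe.1 hT)).2
  exact Finset.mem_coe.2 (Finset.mem_filter.2 ⟨cell_mem T, this⟩)

theorem sq_sum_sqrt_nodalSq_le (v : S.BrokenP1 i) (p : Finset Pt → Prop) [DecidablePred p] {n : ℕ}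
    (hn : (S.cells.filter p).card ≤ n) :
    (∑ T : S.cellsOf i, if p T.1 then √(nodalSq v T) else 0) ^ 2
      ≤ n * ∑ T : S.cellsOf i, if p T.1 then nodalSq v T else 0 := by
  rw [← Finset.sum_filter, ← Finset.sum_filter]
  refine (sq_sum_le_card_mul_sum_sq).trans ?_
  have : ∀ T ∈ Finset.univ.filter (fun T : S.cellsOf i => p T.1),
      √(nodalSq v T) ^ 2 = nodalSq v T :=
    fun T _ => Real.sq_sqrt (nodalSq_nonneg v T)
  rw [Finset.sum_congr rfl this]
  gcongr
  · exact Finset.sum_nonneg fun T _ => nodalSq_nonneg v T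
  · exact (card_filter_cellsOf_le p).trans hn

/-- Exchange of summation: each triangle is counted at most `n` times. This converts local bounds on
edges or patches into global ones. -/
theorem sum_sum_ite_nodalSq_le (v : S.BrokenP1 i) (s : Finset (Finset Pt))
    (r : Finset Pt → Finset Pt → Prop) [∀ F, DecidablePred (r F)] {n : ℕ}
    (hn : ∀ T : S.cellsOf i, (s.filter fun F => r F T.1).card ≤ n) :
    ∑ F ∈ s, ∑ T : S.cellsOf i, (if r F T.1 then nodalSq v T else 0)
      ≤ n * ∑ T : S.cellsOf i, nodalSq v T := by
  rw [Finset.sum_comm, Finset.mul_sum]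
  refine Finset.sum_le_sum fun T _ => ?_
  rw [← Finset.sum_filter, Finset.sum_const, nsmul_eq_mul]
  have := nodalSq_nonneg v T
  gcongr
  exact hn T

theorem volume_hull_le (T : S.cellsOf i) : volume (hull T.1 ∩ S.sub i)
    ≤ ENNReal.ofReal (Metric.diam (hull T.1) ^ 2 * volume.real (Metric.ball (0 : Pt) 1)) := by
  have hd := TriMesh.diam_cell_pos (cell_mem T)
  obtain ⟨N, hN⟩ : T.1.Nonempty := Finset.card_pos.1 (by rw [S.card_cell _ (cell_mem T)]; norm_num)
  have hsub : hull T.1 ∩ S.sub i ⊆ Metric.closedBall N (Metric.diam (hull T.1)) := fun x hx =>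
    TriMesh.dist_le_diam_hull hx.1 (subset_convexHull _ _ hN)
  refine (measure_mono hsub).trans ?_
  rw [Measure.addHaar_closedBall _ _ hd.le, ENNReal.ofReal_mul (by positivity),
    finrank_euclideanSpace, Fintype.card_fin, ofReal_measureReal measure_ball_lt_top.ne]

/-- In the plane the estimate is scale invariant: the squared gradient is of order `h_T⁻²` and the
area of order `h_T²`. -/
theorem gradient_term_le {σ : ℝ} (hσ : 0 < σ) (hS : S.IsRegular σ) (v : S.BrokenP1 i)
    (T : S.cellsOf i) : ∫ x in hull T.1 ∩ S.sub i, ‖gradient (v T) x‖ ^ 2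
      ≤ 4 * σ ^ 2 * volume.real (Metric.ball (0 : Pt) 1) * nodalSq v T := by
  have hd := TriMesh.diam_cell_pos (cell_mem T)
  have hb : ∀ x, ‖gradient (v T) x‖ ^ 2
      ≤ (2 * σ * √(nodalSq v T) / Metric.diam (hull T.1)) ^ 2 := fun x => by
    have := hS.norm_gradient_le hσ (cell_mem T) (v T) (fun P hP => abs_vertex_le v T hP) x
    gcongr
  refine (setIntegral_le_mul (volume_hull_le T) (by positivity) (sq_nonneg _)
    (fun x _ => sq_nonneg _) (fun x _ => hb x)).trans (le_of_eq ?_)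
  rw [div_pow, mul_pow, Real.sq_sqrt (nodalSq_nonneg v T)]
  field_simp
  ring

/-- The factor `8σ²` is `(2σ)²` from the gradient bound times the at most two triangles at `F`;
moreover `h_F ≤ h_T`. -/
theorem normalJump_sq_le {σ : ℝ} (hσ : 0 < σ) (hS : S.IsRegular σ) (v : S.BrokenP1 i)
    {F : Finset Pt} (hF : F ∈ S.edges) (x : Pt) :
    normalJump v F x ^ 2 ≤ 8 * σ ^ 2 / len F ^ 2 *
      ∑ T : S.cellsOf i, if F ⊆ T.1 then nodalSq v T else 0 := by
  have hl := len_pos hF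
  have h1 : |normalJump v F x|
      ≤ 2 * σ / len F * ∑ T : S.cellsOf i, if F ⊆ T.1 then √(nodalSq v T) else 0 := by
    rw [normalJump, Finset.mul_sum]
    refine (Finset.abs_sum_le_sum_abs _ _).trans (Finset.sum_le_sum fun T _ => ?_)
    split_ifs with hFT
    · rw [abs_mul, abs_outSign, one_mul]
      refine (abs_real_inner_le_norm _ _).trans ?_
      rw [S.norm_normal F hF, mul_one]
      refine (hS.norm_gradient_le hσ (cell_mem T) (v T)
        (fun P hP => abs_vertex_le v T hP) x).trans ?_
      rw [div_mul_eq_mul_div]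
      have : len F ≤ Metric.diam (hull T.1) := TriMesh.diam_hull_le hFT
      gcongr
    · simp
  have h2 := sq_sum_sqrt_nodalSq_le v (F ⊆ ·) (TriMesh.card_cells_of_edge_le_two (edge_card hF))
  calc normalJump v F x ^ 2 = |normalJump v F x| ^ 2 := (sq_abs _).symm
    _ ≤ (2 * σ / len F * ∑ T : S.cellsOf i, if F ⊆ T.1 then √(nodalSq v T) else 0) ^ 2 := by gcongr
    _ = (2 * σ / len F) ^ 2 * (∑ T : S.cellsOf i, if F ⊆ T.1 then √(nodalSq v T) else 0) ^ 2 :=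
        mul_pow _ _ _
    _ ≤ (2 * σ / len F) ^ 2 * ((2 : ℕ) * ∑ T : S.cellsOf i,
          if F ⊆ T.1 then nodalSq v T else 0) := by gcongr
    _ = _ := by push_cast; field_simp; ring

theorem sum_ite_nodalSq_nonneg (v : S.BrokenP1 i) (p : Finset Pt → Prop) [DecidablePred p] :
    0 ≤ ∑ T : S.cellsOf i, if p T.1 then nodalSq v T else 0 :=
  Finset.sum_nonneg fun T _ => by
    have := nodalSq_nonneg v T
    split_ifs <;> simp [this]

theorem ghost_term_le {σ : ℝ} (hσ : 0 < σ) (hS : S.IsRegular σ) (v : S.BrokenP1 i)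
    {F : Finset Pt} (hF : F ∈ S.edges) :
    len F * ∫ x in hull F, normalJump v F x ^ 2 ∂μH[1]
      ≤ 8 * σ ^ 2 * ∑ T : S.cellsOf i, if F ⊆ T.1 then nodalSq v T else 0 := by
  have hl := len_pos hF
  have h0 := sum_ite_nodalSq_nonneg v (F ⊆ ·)
  have := setIntegral_le_mul (hausdorffMeasure_hull_edge (edge_card hF)).le hl.le
    (by positivity) (fun x _ => sq_nonneg (normalJump v F x))
    (fun x _ => normalJump_sq_le hσ hS v hF x)
  calc _ ≤ _ := mul_le_mul_of_nonneg_left this hl.le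
    _ = _ := by field_simp

/-- The trace may be taken from a triangle across an edge, so the bound runs over all triangles
sharing a vertex with `T`; there are at most `3⌊σ²⌋` of them. -/
theorem interfaceTrace_sq_le {σ : ℝ} (hσ : 0 < σ) (hS : S.IsRegular σ) (v : S.BrokenP1 i)
    {T : Finset Pt} (hT : T ∈ S.cells) {x : Pt} (hx : x ∈ hull T) :
    interfaceTrace v T x ^ 2 ≤ (3 * ⌊σ ^ 2⌋₊ : ℕ) *
      ∑ T' : S.cellsOf i, if (T ∩ T'.1).Nonempty then nodalSq v T' else 0 := by
  have h1 : |interfaceTrace v T x|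
      ≤ ∑ T' : S.cellsOf i, if (T ∩ T'.1).Nonempty then √(nodalSq v T') else 0 := by
    unfold interfaceTrace
    split_ifs with h
    · have hne : (T ∩ T).Nonempty := by
        rw [Finset.inter_self]
        exact Finset.card_pos.1 (by rw [S.card_cell _ hT]; norm_num)
      refine (abs_apply_le v ⟨T, h⟩ hx).trans ?_
      have := Finset.single_le_sum (s := Finset.univ)
        (f := fun T' : S.cellsOf i => if (T ∩ T'.1).Nonempty then √(nodalSq v T') else 0)
        (fun T' _ => by positivity) (Finset.mem_univ ⟨T, h⟩)
      simpa only [if_pos hne] using this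
    · refine (Finset.abs_sum_le_sum_abs _ _).trans (Finset.sum_le_sum fun T' _ => ?_)
      by_cases h' : (T ∩ T'.1).card = 2 ∧ x ∈ hull T'.1
      · rw [if_pos h', if_pos (Finset.card_pos.1 (by rw [h'.1]; norm_num))]
        exact abs_apply_le v T' h'.2
      · rw [if_neg h', abs_zero]
        positivity
  have h2 := sq_sum_sqrt_nodalSq_le v (fun T' => (T ∩ T').Nonempty) (hS.card_neighbours_le hσ hT)
  rw [← sq_abs]
  refine le_trans ?_ h2
  gcongr

/-- `Γ_T` is a segment inside `T`, so its length is at most `h_T` and cancels the weight. -/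
theorem interface_term_le {σ : ℝ} (hσ : 0 < σ) (hS : S.IsRegular σ) (v : S.D)
    {T : Finset Pt} (hT : T ∈ S.cutCells) :
    (Metric.diam (hull T))⁻¹ * ∫ x in hull T ∩ S.Γ,
        (interfaceTrace (v 0) T x - interfaceTrace (v 1) T x) ^ 2 ∂μH[1]
      ≤ 2 * (3 * ⌊σ ^ 2⌋₊ : ℕ) *
        ((∑ T' : S.cellsOf 0, if (T ∩ T'.1).Nonempty then nodalSq (v 0) T' else 0)
        + ∑ T' : S.cellsOf 1, if (T ∩ T'.1).Nonempty then nodalSq (v 1) T' else 0) := by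
  obtain ⟨hTc, hne⟩ := Finset.mem_filter.1 hT
  have hd := TriMesh.diam_cell_pos hTc
  obtain ⟨p, q, hpq⟩ := S.interface_line T hTc hne
  have hpq' : hull T ∩ S.Γ = segment ℝ p q := hpq
  have hmeas : μH[1] (hull T ∩ S.Γ) ≤ ENNReal.ofReal (Metric.diam (hull T)) := by
    have hp : p ∈ hull T ∩ S.Γ := hpq' ▸ left_mem_segment ℝ p q
    have hq : q ∈ hull T ∩ S.Γ := hpq' ▸ right_mem_segment ℝ p q
    rw [hpq', hausdorffMeasure_segment, edist_dist]
    exact ENNReal.ofReal_le_ofReal (TriMesh.dist_le_diam_hull hp.1 hq.1)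
  have h0 := sum_ite_nodalSq_nonneg (v 0) (fun T' => (T ∩ T').Nonempty)
  have h1 := sum_ite_nodalSq_nonneg (v 1) (fun T' => (T ∩ T').Nonempty)
  have := setIntegral_le_mul hmeas hd.le (B := 2 * (3 * ⌊σ ^ 2⌋₊ : ℕ) *
        ((∑ T' : S.cellsOf 0, if (T ∩ T'.1).Nonempty then nodalSq (v 0) T' else 0)
        + ∑ T' : S.cellsOf 1, if (T ∩ T'.1).Nonempty then nodalSq (v 1) T' else 0))
    (by positivity) (fun x _ => sq_nonneg (interfaceTrace (v 0) T x - interfaceTrace (v 1) T x))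
    (fun x hx => by
      have a0 := interfaceTrace_sq_le hσ hS (v 0) hTc hx.1
      have a1 := interfaceTrace_sq_le hσ hS (v 1) hTc hx.1
      nlinarith [sq_nonneg (interfaceTrace (v 0) T x + interfaceTrace (v 1) T x)])
  calc _ ≤ _ := mul_le_mul_of_nonneg_left this (inv_nonneg.2 hd.le)
    _ = _ := by field_simp

theorem jump_eq_affineMap (v : S.BrokenP1 i) (F : Finset Pt) :
    ∃ a : Pt →ᵃ[ℝ] ℝ, ∀ x, jump v F x = a x := by
  have key : ∀ s : Finset (S.cellsOf i), ∃ a : Pt →ᵃ[ℝ] ℝ, ∀ x,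
      ∑ T ∈ s, (if F ⊆ T.1 then S.outSign T.1 F * v T x else 0) = a x := by
    intro s
    induction s using Finset.induction_on with
    | empty => exact ⟨0, by simp⟩
    | insert T s hT ih =>
      obtain ⟨a, ha⟩ := ih
      refine ⟨(if F ⊆ T.1 then S.outSign T.1 F else 0) • v T + a, fun x => ?_⟩
      rw [Finset.sum_insert hT, ha, AffineMap.coe_add, Pi.add_apply, AffineMap.coe_smul,
        Pi.smul_apply, smul_eq_mul, ite_mul, zero_mul]
  exact key Finset.univ

theorem affine_sq_term_le {F : Finset Pt} (hF : F ∈ S.edges) (a : Pt →ᵃ[ℝ] ℝ) :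
    ∫ x in hull F, a x ^ 2 ∂μH[1] ≤ (∑ N ∈ F, a N ^ 2) * len F := by
  have h0 : 0 ≤ ∑ N ∈ F, a N ^ 2 := Finset.sum_nonneg fun _ _ => sq_nonneg _
  refine setIntegral_le_mul (hausdorffMeasure_hull_edge (edge_card hF)).le (len_pos hF).le h0
    (fun x _ => sq_nonneg _) fun x hx => ?_
  have : |a x| ≤ √(∑ N ∈ F, a N ^ 2) := abs_le_on_convexHull a (fun N hN =>
    Real.abs_le_sqrt (Finset.single_le_sum (f := fun N => a N ^ 2) (fun _ _ => sq_nonneg _) hN)) hx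
  rw [← sq_abs, ← Real.sq_sqrt h0]
  gcongr

end CutMesh

/-! ### The inf-sup condition -/

namespace CutMesh

open scoped Classical

variable {S : CutMesh} {c : EdgeConvention} {i : Fin 2}

/-- No sign condition on `x` is needed, as the square root of a negative number is zero; the
radicands of the norms can be estimated directly. -/
theorem sq_sqrt_le {x y : ℝ} (hy : 0 ≤ y) (h : x ≤ y) : √x ^ 2 ≤ y :=
  calc √x ^ 2 ≤ √y ^ 2 := by gcongr
    _ = y := Real.sq_sqrt hy

theorem edge_mem {F : Finset Pt} (hF : F ∈ S.edgesOf c i) : F ∈ S.edges := (mem_edgesOf.1 hF).1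

theorem sum_nodalSq_nonneg (v : S.BrokenP1 i) : 0 ≤ ∑ T : S.cellsOf i, nodalSq v T :=
  Finset.sum_nonneg fun T _ => nodalSq_nonneg v T

theorem bulk_terms_le {σ : ℝ} (hσ : 0 < σ) (hS : S.IsRegular σ) {κ : ℝ} (hκ : 0 < κ)
    (v : S.BrokenP1 i) :
    (∑ T : S.cellsOf i, κ * ∫ x in hull T.1 ∩ S.sub i, ‖gradient (v T) x‖ ^ 2)
      + ∑ F ∈ S.ghostEdges c i, κ * len F * ∫ x in hull F, normalJump v F x ^ 2 ∂μH[1]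
      ≤ (4 * σ ^ 2 * volume.real (Metric.ball (0 : Pt) 1) + 24 * σ ^ 2)
        * (κ * ∑ T : S.cellsOf i, nodalSq v T) := by
  have h1 : ∑ T : S.cellsOf i, κ * ∫ x in hull T.1 ∩ S.sub i, ‖gradient (v T) x‖ ^ 2
      ≤ κ * (4 * σ ^ 2 * volume.real (Metric.ball (0 : Pt) 1) *
        ∑ T : S.cellsOf i, nodalSq v T) := by
    rw [← Finset.mul_sum, Finset.mul_sum (s := Finset.univ) (f := fun T => nodalSq v T)]
    exact mul_le_mul_of_nonneg_left (Finset.sum_le_sum fun T _ => gradient_term_le hσ hS v T) hκ.le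
  have h2 : ∑ F ∈ S.ghostEdges c i, κ * len F * ∫ x in hull F, normalJump v F x ^ 2 ∂μH[1]
      ≤ κ * (8 * σ ^ 2 * ((3 : ℕ) * ∑ T : S.cellsOf i, nodalSq v T)) := by
    have hsub : S.ghostEdges c i ⊆ S.edges :=
      (Finset.filter_subset _ _).trans (Finset.filter_subset _ _)
    simp_rw [mul_assoc κ]
    rw [← Finset.mul_sum]
    refine mul_le_mul_of_nonneg_left ((Finset.sum_le_sum fun F hF =>
      ghost_term_le hσ hS v (hsub hF)).trans ?_) hκ.le
    rw [← Finset.mul_sum]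
    refine mul_le_mul_of_nonneg_left ?_ (by positivity)
    refine sum_sum_ite_nodalSq_le v _ (fun F T => F ⊆ T) fun T => ?_
    exact (Finset.card_le_card (Finset.filter_subset_filter _ hsub)).trans
      (TriMesh.card_edges_of_cell_le (cell_mem T))
  refine (add_le_add h1 h2).trans (le_of_eq ?_)
  push_cast
  ring

/-- Robustness in the contrast: `k_Γ` is below both coefficients, so each side of the interface jump
is charged to its own subdomain. The factor `18` is `2 · 3²`: two traces, with `3⌊σ²⌋` neighbours
counted once in the trace bound and once as overlap. -/
theorem interface_terms_le {σ : ℝ} (hσ : 0 < σ) (hS : S.IsRegular σ) {k : Fin 2 → ℝ}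
    (hk : ∀ i, 0 < k i) (v : S.D) :
    ∑ T ∈ S.cutCells, k 0 * k 1 / (k 0 + k 1) / Metric.diam (hull T) *
        (∫ x in hull T ∩ S.Γ,
          (interfaceTrace (v 0) T x - interfaceTrace (v 1) T x) ^ 2 ∂μH[1])
      ≤ 18 * (⌊σ ^ 2⌋₊ : ℝ) ^ 2 * ∑ i, k i * ∑ T : S.cellsOf i, nodalSq (v i) T := by
  have hk0 := hk 0
  have hk1 := hk 1
  set κ := k 0 * k 1 / (k 0 + k 1) with hκ
  have hκ0 : κ ≤ k 0 := by
    rw [hκ, div_le_iff₀ (by positivity)]; nlinarith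
  have hκ1 : κ ≤ k 1 := by
    rw [hκ, div_le_iff₀ (by positivity)]; nlinarith
  have hκp : 0 ≤ κ := by positivity
  set s : (i : Fin 2) → Finset Pt → ℝ := fun i T =>
    ∑ T' : S.cellsOf i, if (T ∩ T'.1).Nonempty then nodalSq (v i) T' else 0 with hs
  have hs0 : ∀ i T, 0 ≤ s i T := fun i T =>
    sum_ite_nodalSq_nonneg (v i) (fun T' => (T ∩ T').Nonempty)
  have hsum : ∀ i, ∑ T ∈ S.cutCells, s i T
      ≤ (3 * ⌊σ ^ 2⌋₊ : ℕ) * ∑ T : S.cellsOf i, nodalSq (v i) T := fun i => by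
    refine sum_sum_ite_nodalSq_le (v i) _ (fun T T' => (T ∩ T').Nonempty) fun T' => ?_
    refine (Finset.card_le_card ?_).trans (hS.card_neighbours_le hσ (cell_mem T'))
    intro T hT
    obtain ⟨hT, hne⟩ := Finset.mem_filter.1 hT
    exact Finset.mem_filter.2 ⟨(Finset.mem_filter.1 hT).1, by rwa [Finset.inter_comm]⟩
  have hterm : ∀ T ∈ S.cutCells, κ / Metric.diam (hull T) * (∫ x in hull T ∩ S.Γ,
      (interfaceTrace (v 0) T x - interfaceTrace (v 1) T x) ^ 2 ∂μH[1])
      ≤ 2 * (3 * ⌊σ ^ 2⌋₊ : ℕ) * (k 0 * s 0 T + k 1 * s 1 T) := fun T hT => by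
    have h1 := mul_le_mul_of_nonneg_left (interface_term_le hσ hS v hT) hκp
    rw [div_eq_mul_inv, mul_assoc]
    refine h1.trans ?_
    change κ * (2 * (3 * ⌊σ ^ 2⌋₊ : ℕ) * (s 0 T + s 1 T)) ≤ _
    have a0 := mul_le_mul_of_nonneg_right hκ0 (hs0 0 T)
    have a1 := mul_le_mul_of_nonneg_right hκ1 (hs0 1 T)
    calc κ * (2 * (3 * ⌊σ ^ 2⌋₊ : ℕ) * (s 0 T + s 1 T))
        = 2 * (3 * ⌊σ ^ 2⌋₊ : ℕ) * (κ * s 0 T + κ * s 1 T) := by ring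
      _ ≤ _ := by gcongr
  refine (Finset.sum_le_sum hterm).trans ?_
  rw [← Finset.mul_sum, Finset.sum_add_distrib, ← Finset.mul_sum, ← Finset.mul_sum,
    Fin.sum_univ_two]
  calc _ ≤ 2 * ((3 * ⌊σ ^ 2⌋₊ : ℕ) : ℝ) *
        (k 0 * ((3 * ⌊σ ^ 2⌋₊ : ℕ) * ∑ T : S.cellsOf 0, nodalSq (v 0) T)
        + k 1 * ((3 * ⌊σ ^ 2⌋₊ : ℕ) * ∑ T : S.cellsOf 1, nodalSq (v 1) T)) := by
        have h0 := hsum 0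
        have h1 := hsum 1
        gcongr
    _ = _ := by push_cast; ring

/-- The norm of `𝓓_h` is bounded by nodal values and jumps at the nodes. -/
theorem normD_sq_le {σ : ℝ} (hσ : 0 < σ) (hS : S.IsRegular σ) {k : Fin 2 → ℝ}
    (hk : ∀ i, 0 < k i) (v : S.D) :
    normD c k v ^ 2 ≤ (4 * σ ^ 2 * volume.real (Metric.ball (0 : Pt) 1) + 24 * σ ^ 2
        + 18 * (⌊σ ^ 2⌋₊ : ℝ) ^ 2) * (∑ i, k i * ∑ T : S.cellsOf i, nodalSq (v i) T)
      + ∑ i, k i * ∑ F ∈ S.edgesOf c i, ∑ N ∈ F, jump (v i) F N ^ 2 := by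
  have hE : 0 ≤ ∑ i, k i * ∑ T : S.cellsOf i, nodalSq (v i) T :=
    Finset.sum_nonneg fun i _ => mul_nonneg (hk i).le (sum_nodalSq_nonneg (v i))
  have hJ : 0 ≤ ∑ i, k i * ∑ F ∈ S.edgesOf c i, ∑ N ∈ F, jump (v i) F N ^ 2 :=
    Finset.sum_nonneg fun i _ => mul_nonneg (hk i).le
      (Finset.sum_nonneg fun _ _ => Finset.sum_nonneg fun _ _ => sq_nonneg _)
  refine sq_sqrt_le (by positivity) (add_le_add ?_ ?_)
  · refine sq_sqrt_le (by positivity) ?_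
    rw [add_mul]
    refine add_le_add ?_ (interface_terms_le hσ hS hk v)
    rw [Finset.mul_sum]
    exact Finset.sum_le_sum fun i _ => bulk_terms_le hσ hS (hk i) (v i)
  · refine Finset.sum_le_sum fun i _ => ?_
    rw [Finset.mul_sum]
    refine Finset.sum_le_sum fun F hF => ?_
    have hl := len_pos (edge_mem hF)
    obtain ⟨a, ha⟩ := jump_eq_affineMap (v i) F
    simp only [ha]
    have := affine_sq_term_le (edge_mem hF) a
    have hki := hk i
    calc k i * (len F)⁻¹ * ∫ x in hull F, a x ^ 2 ∂μH[1]
        ≤ k i * (len F)⁻¹ * ((∑ N ∈ F, a N ^ 2) * len F) := by gcongr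
      _ = _ := by field_simp

/-- Ensures that the constructed `v` is admissible in the supremum. -/
theorem normD_pos {k : Fin 2 → ℝ} (hk : ∀ i, 0 < k i) (v : S.D) {F : Finset Pt}
    (hF : F ∈ S.edgesOf c i) {N : Pt} (hN : N ∈ F) (hj : jump (v i) F N ≠ 0) :
    0 < normD c k v := by
  have hterm : ∀ i, ∀ F ∈ S.edgesOf c i,
      0 ≤ k i * (len F)⁻¹ * (∫ x in hull F, jump (v i) F x ^ 2 ∂μH[1]) := fun i F hF => by
    have := hk i
    have := len_pos (edge_mem hF)
    have : 0 ≤ ∫ x in hull F, jump (v i) F x ^ 2 ∂μH[1] := integral_nonneg fun _ => sq_nonneg _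
    positivity
  refine Real.sqrt_pos.2 (add_pos_of_nonneg_of_pos (sq_nonneg _) ?_)
  refine Finset.sum_pos' (fun i _ => Finset.sum_nonneg (hterm i)) ⟨i, Finset.mem_univ i, ?_⟩
  refine Finset.sum_pos' (hterm i) ⟨F, hF, ?_⟩
  obtain ⟨a, ha⟩ := jump_eq_affineMap (v i) F
  simp only [ha] at hj ⊢
  have h1 := setIntegral_sq_pos (edge_card (edge_mem hF)) a hN hj
  have h2 := hk i
  have h3 := len_pos (edge_mem hF)
  positivity

theorem exists_affineMap_of_mem_M {μ : (i : Fin 2) → S.edgesOf c i → Pt → ℝ} (hμ : μ ∈ S.M c)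
    (i : Fin 2) (F : S.edgesOf c i) : ∃ a : Pt →ᵃ[ℝ] ℝ, (∀ x ∈ hull F.1, μ i F x = a x) ∧
      ∀ x ∉ hull F.1, μ i F x = 0 := by
  obtain ⟨a, ha⟩ := (hμ i).1 F
  refine ⟨a, fun x hx => ?_, fun x hx => ?_⟩
  · rw [ha, Set.indicator_of_mem hx]
  · rw [ha, Set.indicator_of_notMem hx]

/-- Because multipliers are extended by zero off their edge, a non-zero one is non-zero on some
edge, and an affine function vanishing at both endpoints vanishes there. -/
theorem exists_vertex_ne_zero {μ : (i : Fin 2) → S.edgesOf c i → Pt → ℝ} (hμ : μ ∈ S.M c)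
    (h0 : μ ≠ 0) : ∃ (i : Fin 2) (F : S.edgesOf c i), ∃ N ∈ F.1, μ i F N ≠ 0 := by
  by_contra! h
  refine h0 ?_
  funext i F x
  obtain ⟨a, ha, ha'⟩ := exists_affineMap_of_mem_M hμ i F
  by_cases hx : x ∈ hull F.1
  · rw [ha x hx]
    refine eq_zero_on_convexHull a (fun N hN => ?_) hx
    rw [← ha N (subset_convexHull _ _ hN)]
    exact h i F N hN
  · exact ha' x hx

theorem setIntegral_multiplier_eq {μ : (i : Fin 2) → S.edgesOf c i → Pt → ℝ} {i : Fin 2}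
    {F : S.edgesOf c i} {a : Pt →ᵃ[ℝ] ℝ} (ha : ∀ x ∈ hull F.1, μ i F x = a x) :
    ∫ x in hull F.1, μ i F x ^ 2 ∂μH[1] = ∫ x in hull F.1, a x ^ 2 ∂μH[1] :=
  setIntegral_congr_fun (isClosed_hull F.1).measurableSet fun x hx => by
    simp only [ha x hx]

theorem normM_sq_le {k : Fin 2 → ℝ} (hk : ∀ i, 0 < k i)
    {μ : (i : Fin 2) → S.edgesOf c i → Pt → ℝ} (hμ : μ ∈ S.M c) :
    normM k μ ^ 2 ≤ ∑ i, k i * ∑ F : S.edgesOf c i, ∑ N ∈ F.1, (len F.1 * μ i F N) ^ 2 := by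
  refine sq_sqrt_le (Finset.sum_nonneg fun i _ => mul_nonneg (hk i).le
    (Finset.sum_nonneg fun _ _ => Finset.sum_nonneg fun _ _ => sq_nonneg _)) ?_
  refine Finset.sum_le_sum fun i _ => ?_
  rw [Finset.mul_sum]
  refine Finset.sum_le_sum fun F _ => ?_
  obtain ⟨a, ha, -⟩ := exists_affineMap_of_mem_M hμ i F
  have hki := hk i
  have hl := len_pos (edge_mem F.2)
  rw [setIntegral_multiplier_eq ha]
  calc k i * len F.1 * ∫ x in hull F.1, a x ^ 2 ∂μH[1]
      ≤ k i * len F.1 * ((∑ N ∈ F.1, a N ^ 2) * len F.1) := by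
        have := affine_sq_term_le (edge_mem F.2) a
        gcongr
    _ = k i * ∑ N ∈ F.1, (len F.1 * a N) ^ 2 := by
        simp_rw [mul_pow]; rw [← Finset.mul_sum]; ring
    _ = _ := by
        congr 1
        exact Finset.sum_congr rfl fun N hN => by rw [ha N (subset_convexHull _ _ hN)]

theorem normM_pos {k : Fin 2 → ℝ} (hk : ∀ i, 0 < k i)
    {μ : (i : Fin 2) → S.edgesOf c i → Pt → ℝ} (hμ : μ ∈ S.M c) {i : Fin 2} {F : S.edgesOf c i}
    {N : Pt} (hN : N ∈ F.1) (h : μ i F N ≠ 0) : 0 < normM k μ := by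
  have hterm : ∀ i, ∀ F : S.edgesOf c i,
      0 ≤ k i * len F.1 * (∫ x in hull F.1, μ i F x ^ 2 ∂μH[1]) := fun i F => by
    have := hk i
    have := len_pos (edge_mem F.2)
    have : 0 ≤ ∫ x in hull F.1, μ i F x ^ 2 ∂μH[1] := integral_nonneg fun _ => sq_nonneg _
    positivity
  refine Real.sqrt_pos.2 ?_
  refine Finset.sum_pos' (fun i _ => Finset.sum_nonneg fun F _ => hterm i F)
    ⟨i, Finset.mem_univ i, ?_⟩
  refine Finset.sum_pos' (fun F _ => hterm i F) ⟨F, Finset.mem_univ F, ?_⟩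
  obtain ⟨a, ha, -⟩ := exists_affineMap_of_mem_M hμ i F
  rw [setIntegral_multiplier_eq ha]
  rw [ha N (subset_convexHull _ _ hN)] at h
  have h1 := setIntegral_sq_pos (edge_card (edge_mem F.2)) a hN h
  have h2 := hk i
  have h3 := len_pos (edge_mem F.2)
  positivity

/-- For a multiplier `μ` there is a function whose jump at the endpoints `N` of each edge `F` is
`h_F μ|_F(N)`, with nodal values bounded by those of `μ`. -/
theorem exists_broken_of_multiplier {σ : ℝ} (hσ : 0 < σ) : ∃ C : ℝ, 0 ≤ C ∧
    ∀ S : CutMesh, S.IsRegular σ → ∀ c : EdgeConvention,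
    (c = .withBoundary → S.HasSimpleBoundary) → ∀ μ ∈ S.M c, ∀ i : Fin 2,
    ∃ v : S.BrokenP1 i,
      (∀ F : S.edgesOf c i, ∀ N ∈ F.1, jump v F.1 N = len F.1 * μ i F N) ∧
      ∑ T : S.cellsOf i, nodalSq v T
        ≤ C * ∑ F : S.edgesOf c i, ∑ N ∈ F.1, (len F.1 * μ i F N) ^ 2 := by
  obtain ⟨C, hC0, hC⟩ := exists_nodal_values hσ
  refine ⟨C * ⌊σ ^ 2⌋₊, by positivity, fun S hS c hc μ hμ i => ?_⟩
  set g : Pt → Finset Pt → ℝ := fun N F =>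
    if h : F ∈ S.edgesOf c i then len F * μ i ⟨F, h⟩ N else 0 with hg
  have hgF : ∀ (N : Pt) (F : S.edgesOf c i), g N F.1 = len F.1 * μ i F N := fun N F => by
    simp only [hg, dif_pos F.2]
  choose f hf hfb using fun N => hC S hS c hc i N (g N) fun hN => by
    rw [Finset.sum_filter, ← Finset.sum_coe_sort]
    refine (Finset.sum_congr rfl fun F _ => ?_).trans ((hμ i).2 N hN)
    rw [hgF, mul_assoc]
  choose v hv using fun T : S.cellsOf i =>
    exists_affineMap_eq (TriMesh.isTriangle (cell_mem T)) fun N => f N T.1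
  refine ⟨v, fun F N hN => ?_, ?_⟩
  · rw [← hgF, ← hf N F.1 F.2 hN, ← Finset.sum_coe_sort, jump]
    refine Finset.sum_congr rfl fun T _ => ?_
    split_ifs with h
    · rw [hv T N (h hN)]
    · rfl
  · set w : Pt → ℝ := fun N => ∑ F ∈ (S.edgesOf c i).filter (N ∈ ·), g N F ^ 2 with hw
    have hw0 : ∀ N, 0 ≤ w N := fun N => Finset.sum_nonneg fun _ _ => sq_nonneg _
    have h1 : ∀ T : S.cellsOf i, nodalSq v T ≤ ∑ N ∈ S.nodes, if N ∈ T.1 then C * w N else 0 := by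
      intro T
      rw [← Finset.sum_filter]
      have hsub : T.1 ⊆ S.nodes.filter (· ∈ T.1) := fun N hN =>
        Finset.mem_filter.2 ⟨Finset.mem_biUnion.2 ⟨T.1, cell_mem T, hN⟩, hN⟩
      calc nodalSq v T ≤ ∑ N ∈ T.1, C * w N :=
            Finset.sum_le_sum fun N hN => by rw [hv T N hN]; exact hfb N T.1
        _ ≤ _ := Finset.sum_le_sum_of_subset_of_nonneg hsub
            fun N _ _ => mul_nonneg hC0 (hw0 N)
    calc ∑ T : S.cellsOf i, nodalSq v T
        ≤ ∑ T : S.cellsOf i, ∑ N ∈ S.nodes, (if N ∈ T.1 then C * w N else 0) :=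
          Finset.sum_le_sum fun T _ => h1 T
      _ = ∑ N ∈ S.nodes, ∑ T : S.cellsOf i, (if N ∈ T.1 then C * w N else 0) := Finset.sum_comm
      -- The bound `C * w N` does not depend on the triangle, and at most `⌊σ²⌋` triangles share the
      -- node.
      _ ≤ ∑ N ∈ S.nodes, (⌊σ ^ 2⌋₊ : ℝ) * (C * w N) := by
          refine Finset.sum_le_sum fun N _ => ?_
          rw [← Finset.sum_filter, Finset.sum_const, nsmul_eq_mul]
          have := mul_nonneg hC0 (hw0 N)
          gcongr
          exact (card_filter_cellsOf_le (N ∈ ·)).trans (hS.card_cells_at_le hσ N)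
      _ = C * ⌊σ ^ 2⌋₊ * ∑ N ∈ S.nodes, w N := by
          rw [Finset.mul_sum]
          exact Finset.sum_congr rfl fun N _ => by ring
      _ ≤ _ := by
          refine mul_le_mul_of_nonneg_left (le_of_eq ?_) (by positivity)
          simp only [hw, Finset.sum_filter]
          rw [Finset.sum_comm, ← Finset.sum_coe_sort]
          refine Finset.sum_congr rfl fun F _ => ?_
          rw [← Finset.sum_filter]
          have hset : S.nodes.filter (· ∈ F.1) = F.1 := by
            ext N
            rw [Finset.mem_filter, and_iff_right_iff_imp]
            intro hN
            obtain ⟨-, T, hT, hFT⟩ := TriMesh.mem_edges_iff.1 (edge_mem F.2)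
            exact Finset.mem_biUnion.2 ⟨T, hT, hFT hN⟩
          rw [hset]
          exact Finset.sum_congr rfl fun N _ => by rw [hgF]

theorem exists_le_infSup {σ : ℝ} (hσ : 0 < σ) : ∃ β : ℝ, 0 < β ∧
    ∀ S : CutMesh, S.IsRegular σ → ∀ k : Fin 2 → ℝ, (∀ i, 0 < k i) → ∀ c : EdgeConvention,
    (c = .withBoundary → S.HasSimpleBoundary) → (β : EReal) ≤ S.infSup c k := by
  obtain ⟨C, hC0, hC⟩ := exists_broken_of_multiplier hσ
  set C₁ : ℝ := 4 * σ ^ 2 * volume.real (Metric.ball (0 : Pt) 1) + 24 * σ ^ 2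
        + 18 * (⌊σ ^ 2⌋₊ : ℝ) ^ 2 with hC₁
  have hC₁0 : 0 ≤ C₁ := by positivity
  -- `C₁ * C` bounds the nodal part of the squared norm of `v`, and the summand `1` is the jump
  -- part, which is at most `Q` since the jumps are prescribed.
  set B := √(C₁ * C + 1) with hB
  have hB0 : 0 < B := Real.sqrt_pos.2 (by positivity)
  refine ⟨1 / (2 * B), by positivity, fun S hS k hk c hc => ?_⟩
  refine le_iInf₂ fun μ hμ => le_iInf fun hμ0 => ?_
  choose v hvj hvb using hC S hS c hc μ hμ
  obtain ⟨i₀, F₀, N₀, hN₀, hμN⟩ := exists_vertex_ne_zero hμ hμ0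
  have hMpos := normM_pos hk hμ hN₀ hμN
  have hDpos : 0 < normD c k v := normD_pos hk v F₀.2 hN₀ (by
    rw [hvj i₀ F₀ N₀ hN₀]
    exact mul_ne_zero (len_pos (edge_mem F₀.2)).ne' hμN)
  refine le_iSup₂_of_le v hDpos.ne' (EReal.coe_le_coe_iff.2 ?_)
  set Q := ∑ i, k i * ∑ F : S.edgesOf c i, ∑ N ∈ F.1, (len F.1 * μ i F N) ^ 2 with hQ
  have hM : normM k μ ^ 2 ≤ Q := normM_sq_le hk hμ
  have hQ0 : 0 < Q := (by positivity : 0 < normM k μ ^ 2).trans_le hM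
  have hb : b k μ v = Q / 2 := by
    rw [b, hQ, Finset.sum_div]
    refine Finset.sum_congr rfl fun i _ => ?_
    rw [Finset.mul_sum, Finset.sum_div]
    refine Finset.sum_congr rfl fun F _ => ?_
    rw [Finset.mul_sum, Finset.mul_sum, Finset.sum_div]
    refine Finset.sum_congr rfl fun N hN => ?_
    rw [hvj i F N hN]
    ring
  have hD : normD c k v ^ 2 ≤ (C₁ * C + 1) * Q := by
    refine (normD_sq_le hσ hS hk v).trans ?_
    rw [add_mul (C₁ * C), one_mul, mul_assoc C₁]
    refine add_le_add (mul_le_mul_of_nonneg_left ?_ hC₁0) (le_of_eq ?_)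
    · rw [hQ, Finset.mul_sum]
      refine Finset.sum_le_sum fun i _ => ?_
      rw [mul_left_comm]
      exact mul_le_mul_of_nonneg_left (hvb i) (hk i).le
    · refine Finset.sum_congr rfl fun i _ => ?_
      rw [← Finset.sum_coe_sort]
      congr 1
      exact Finset.sum_congr rfl fun F _ => Finset.sum_congr rfl fun N hN => by rw [hvj i F N hN]
  have hM' : normM k μ ≤ √Q := Real.le_sqrt_of_sq_le hM
  have hD' : normD c k v ≤ B * √Q := by
    rw [hB, ← Real.sqrt_mul (by positivity)]
    exact Real.le_sqrt_of_sq_le hD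
  rw [hb, div_le_div_iff₀ (by positivity) (by positivity)]
  calc 1 * (normM k μ * normD c k v) ≤ √Q * (B * √Q) := by
        rw [one_mul]
        gcongr
    _ = B * (√Q * √Q) := by ring
    _ = B * Q := by rw [Real.mul_self_sqrt hQ0.le]
    _ = _ := by ring

end CutMesh

theorem mainTheorem5 (σ : ℝ) (hσ : 0 < σ) :
    ∃ β : ℝ, 0 < β ∧ ∀ S : CutMesh, S.IsRegular σ →
      ∀ k : Fin 2 → ℝ, (∀ i, 0 < k i) →
        (β : EReal) ≤ S.infSup .interior k ∧
        (S.HasSimpleBoundary → (β : EReal) ≤ S.infSup .withBoundary k) := by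
  obtain ⟨β, hβ, h⟩ := CutMesh.exists_le_infSup hσ
  exact ⟨β, hβ, fun S hS k hk => ⟨h S hS k hk .interior nofun,
    fun hb => h S hS k hk .withBoundary fun _ => hb⟩⟩
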